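/- For a partition $\lambda$ of $k$ let $\chi^\lambda$ denote the irreducible complex character of the symmetric group $S_k$ labelled by $\lambda$ (the character of the Specht module $S^\lambda$). For partitions $\sigma$ of $a$, $\tau$ of $b$ and $\lambda$ of $a+b$ let $c^\lambda_{\sigma,\tau}$ denote the Littlewood--Richardson coefficient, that is, the multiplicity of $\chi^\lambda$ in the induced character $(\chi^\sigma\times\chi^\tau)\big\uparrow_{S_a\times S_b}^{S_{a+b}}$. For a partition $\alpha$ of $k$ let $2\alpha$ be the partition of $2k$ obtained by doubling every part of $\alpha$. For a partition $\nu$ of $n$ let \[ \phi^{(2^n)}_\nu = \left(\mathrm{Inf}\,\chi^\nu\right)\big\uparrow_{S_2\wr S_n}^{S_{2n}} \] be the twisted Foulkes character, where $\mathrm{Inf}\,\chi^\nu$ is the inflation of $\chi^\nu$ along the canonical surjection $S_2\wr S_n\to S_n$. Theorem. Let $n$ and $r$ be non-negative integers with $2r\le n$, so that $(n-r,r)$ is a partition of $n$ (zero parts being omitted). Then \[ \phi^{(2^n)}_{(n-r,r)} = \sum_{\lambda\vdash 2n}\Bigg( \sum_{\alpha\vdash n-r}\ \sum_{\beta\vdash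 r} c^\lambda_{2\alpha,2\beta} \;-\; \sum_{\gamma\vdash n-r+1}\ \sum_{\delta\vdash r-1} c^\lambda_{2\gamma,2\delta}\Bigg)\chi^\lambda, \] where the second double sum is empty, hence $0$, if $r=0$. -/

import Mathlib

open scoped BigOperators

noncomputable section

namespace TwistedFoulkes

/-! ### Partitions -/

/-- The Young diagram of a partition: its rows are the parts in weakly decreasing order. -/
def diagram {n : ℕ} (p : n.Partition) : YoungDiagram :=
  YoungDiagram.ofRowLens (p.parts.sort (· ≥ ·)) (p.parts.pairwise_sort (· ≥ ·)).sortedGE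

/-- The partition `2α` of `2n`, obtained from `α ⊢ n` by doubling every part. -/
def double {n : ℕ} (p : n.Partition) : (2 * n).Partition where
  parts := p.parts.map (2 * ·)
  parts_pos := by
    intro i hi
    obtain ⟨j, hj, rfl⟩ := Multiset.mem_map.1 hi
    have := p.parts_pos hj
    omega
  parts_sum := by
    rw [Multiset.sum_map_mul_left, Multiset.map_id', p.parts_sum]

/-- The partition `(n - r, r)` of `n`, for `r ≤ n - r`; zero parts are dropped. -/
def twoRow (n r : ℕ) (h : 2 * r ≤ n) : n.Partition :=
  Nat.Partition.ofSums n {n - r, r} (by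
    rw [Multiset.insert_eq_cons, Multiset.sum_cons, Multiset.sum_singleton]; omega)

/-! ### Specht modules

Everything is done for the symmetric group on an arbitrary finite set `X`. If `X` has not as many
elements as the diagram has cells, there are no tableaux and the Specht module is zero. -/

section Specht

variable {X : Type} [Fintype X] [DecidableEq X]

/-- A `μ`-tableau with entries in `X`: a bijective filling of the cells of `μ`
by the elements of `X`. The cell `(i, j)` lies in row `i` and column `j`. -/
abbrev Tableau (μ : YoungDiagram) (X : Type) : Type := μ.cells ≃ X

/-- The row of `t` that contains `x`. As a function of `x`, this is the tabloid of `t`: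
two tableaux are row equivalent if and only if these functions agree. -/
def Tableau.row {μ : YoungDiagram} (t : Tableau μ X) (x : X) : ℕ := (t.symm x).1.1

/-- The column of `t` that contains `x`. -/
def Tableau.col {μ : YoungDiagram} (t : Tableau μ X) (x : X) : ℕ := (t.symm x).1.2

/-- The permutation representation over `ℂ` on the vector space with basis the functions `X → ℕ`,
where `g` sends the basis vector of `f` to that of `x ↦ f (g⁻¹ x)`. It contains, for every `μ`,
the permutation module on the `μ`-tabloids. -/
def tabloidRep (X : Type) : Representation ℂ (Equiv.Perm X) ((X → ℕ) →₀ ℂ) where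
  toFun g := Finsupp.lmapDomain ℂ ℂ (fun f => f ∘ ⇑g⁻¹)
  map_one' := by
    ext f : 2
    simp [Finsupp.lmapDomain_apply]
  map_mul' g h := by
    ext f : 2
    simp [Finsupp.lmapDomain_apply, Function.comp_assoc]

/-- The polytabloid `∑ sgn(π) {π t}`, the sum being over the permutations `π` that preserve every
column of `t`. -/
def polytabloid {μ : YoungDiagram} (t : Tableau μ X) : (X → ℕ) →₀ ℂ :=
  ∑ π : Equiv.Perm X with ∀ x, t.col (π x) = t.col x,
    Finsupp.single (t.row ∘ ⇑π⁻¹) ((Equiv.Perm.sign π : ℤ) : ℂ)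

theorem tabloidRep_polytabloid {μ : YoungDiagram} (g : Equiv.Perm X) (t : Tableau μ X) :
    tabloidRep X g (polytabloid t) = polytabloid (t.trans g) := by
  classical
  simp only [polytabloid, tabloidRep, MonoidHom.coe_mk, OneHom.coe_mk, map_sum,
    Finsupp.lmapDomain_apply, Finsupp.mapDomain_single]
  refine Finset.sum_bij' (fun π _ => g * π * g⁻¹) (fun π _ => g⁻¹ * π * g) ?_ ?_ ?_ ?_ ?_
  · intro π hπ
    simp only [Finset.mem_filter, Finset.mem_univ, true_and] at hπ ⊢
    intro x
    simpa [Tableau.col, Equiv.Perm.inv_def] using hπ (g⁻¹ x)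
  · intro π hπ
    simp only [Finset.mem_filter, Finset.mem_univ, true_and] at hπ ⊢
    intro x
    simpa [Tableau.col, Equiv.Perm.inv_def] using hπ (g x)
  · intro π _
    group
  · intro π _
    group
  · intro π _
    congr 1
    · funext x
      simp [Tableau.row, Equiv.Perm.inv_def, Equiv.Perm.mul_def]
    · have : Equiv.Perm.sign (g * π * g⁻¹) = Equiv.Perm.sign π := by
        rw [map_mul, map_mul, mul_right_comm, ← map_mul, mul_inv_cancel, map_one, one_mul]
      rw [this]

/-- The Specht module `S^μ`: the subrepresentation spanned by the polytabloids. -/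
def spechtSub (μ : YoungDiagram) (X : Type) [Fintype X] [DecidableEq X] :
    Subrepresentation (tabloidRep X) where
  toSubmodule := Submodule.span ℂ (Set.range (polytabloid : Tableau μ X → _))
  apply_mem_toSubmodule g v hv := by
    induction hv using Submodule.span_induction with
    | mem v hv =>
      obtain ⟨t, rfl⟩ := hv
      rw [tabloidRep_polytabloid]
      exact Submodule.subset_span ⟨_, rfl⟩
    | zero => rw [map_zero]; exact Submodule.zero_mem _
    | add v w _ _ hv hw => rw [map_add]; exact Submodule.add_mem _ hv hw
    | smul c v _ hv => rw [map_smul]; exact Submodule.smul_mem _ c hv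

/-- The underlying space of the Specht module labelled by the partition `p`. -/
def SpechtModule {n : ℕ} (p : n.Partition) (X : Type) [Fintype X] [DecidableEq X] : Type :=
  (spechtSub (diagram p) X).toSubmodule

instance {n : ℕ} (p : n.Partition) (X : Type) [Fintype X] [DecidableEq X] :
    AddCommGroup (SpechtModule p X) :=
  inferInstanceAs (AddCommGroup (spechtSub (diagram p) X).toSubmodule)

instance {n : ℕ} (p : n.Partition) (X : Type) [Fintype X] [DecidableEq X] :
    Module ℂ (SpechtModule p X) :=
  inferInstanceAs (Module ℂ (spechtSub (diagram p) X).toSubmodule)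

/-- The Specht module labelled by the partition `p`, as a representation of the symmetric group
on `X`. -/
def specht {n : ℕ} (p : n.Partition) (X : Type) [Fintype X] [DecidableEq X] :
    Representation ℂ (Equiv.Perm X) (SpechtModule p X) :=
  (spechtSub (diagram p) X).toRepresentation

/-- The irreducible character `χ^p` of the symmetric group on a set `X` with `n` elements,
for a partition `p` of `n`. -/
def chi {n : ℕ} (p : n.Partition) (X : Type) [Fintype X] [DecidableEq X] : Equiv.Perm X → ℂ :=
  (specht p X).character

end Specht

/-! ### Littlewood–Richardson coefficients -/

/-- The representation of `S_a × S_b` on the outer tensor product of the Specht modules of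
`σ` and `τ`. -/
def outerSpecht {a b : ℕ} (σ : a.Partition) (τ : b.Partition) :
    Representation ℂ (Equiv.Perm (Fin a) × Equiv.Perm (Fin b))
      (TensorProduct ℂ (SpechtModule σ (Fin a)) (SpechtModule τ (Fin b))) :=
  Representation.tprod
    ((specht σ (Fin a)).comp (MonoidHom.fst (Equiv.Perm (Fin a)) (Equiv.Perm (Fin b))))
    ((specht τ (Fin b)).comp (MonoidHom.snd (Equiv.Perm (Fin a)) (Equiv.Perm (Fin b))))

/-- The Littlewood–Richardson coefficient `c^l_{σ,τ}`: the multiplicity of the Specht module of `l`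
in the representation of `S_{a+b}` induced from that of `S_a × S_b` on the outer tensor product
of the Specht modules of `σ` and `τ`. It is `0` unless `l` is a partition of `a + b`. -/
def lrCoeff {k a b : ℕ} (l : k.Partition) (σ : a.Partition) (τ : b.Partition) : ℕ :=
  Module.finrank ℂ (Representation.IntertwiningMap (specht l (Fin a ⊕ Fin b))
    (Representation.ind (Equiv.Perm.sumCongrHom (Fin a) (Fin b)) (outerSpecht σ τ)))

/-! ### Twisted Foulkes characters -/

/-- The wreath product `S_m ≀ S_n`: the semidirect product of `(S_m)^n` and `S_n`, where `S_n`
permutes the `n` factors. -/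
abbrev Wreath (m n : ℕ) : Type :=
  (Fin n → Equiv.Perm (Fin m)) ⋊[mulAutArrow] Equiv.Perm (Fin n)

/-- The imprimitive action of `S_m ≀ S_n` on `n` blocks of size `m`, as a homomorphism to the
symmetric group on `Fin n × Fin m`: the element `(f, s)` sends `(i, x)` to `(s i, f (s i) x)`. -/
def wreathEmb (m n : ℕ) : Wreath m n →* Equiv.Perm (Fin n × Fin m) where
  toFun w :=
    { toFun := fun z => (w.right z.1, w.left (w.right z.1) z.2)
      invFun := fun z => (w.right⁻¹ z.1, (w.left z.1)⁻¹ z.2)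
      left_inv := fun z => by simp
      right_inv := fun z => by simp }
  map_one' := by
    ext z <;> simp
  map_mul' v w := by
    have key : ∀ i, (mulAutArrow v.right w.left) (v.right i) = w.left i := fun i =>
      congrArg w.left (v.right.symm_apply_apply i)
    ext z
    · simp
    · simp only [SemidirectProduct.mul_left, SemidirectProduct.mul_right, Pi.mul_apply,
        Equiv.Perm.mul_apply, Equiv.coe_fn_mk, key]

/-- The twisted Foulkes character `φ_ν^{(m^n)}`, for a partition `ν` of `n`: the character of the
symmetric group on `Fin n × Fin m` (a set with `mn` elements) that is obtained by inflating `χ^ν`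
along the canonical surjection `S_m ≀ S_n → S_n` and inducing to the symmetric group. -/
def foulkes (m : ℕ) {n : ℕ} (ν : n.Partition) : Equiv.Perm (Fin n × Fin m) → ℂ :=
  (Representation.ind (wreathEmb m n)
    ((specht ν (Fin n)).comp
      (SemidirectProduct.rightHom : Wreath m n →* Equiv.Perm (Fin n)))).character

end TwistedFoulkes

end

noncomputable section

set_option linter.unusedSectionVars false

namespace TwistedFoulkes

/-! ### Young diagrams of partitions -/

theorem lt_countP_iff_of_sortedGE (j : ℕ) :
    ∀ (w : List ℕ), w.SortedGE → ∀ i : ℕ,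
      (∃ h : i < w.length, j < w[i]) ↔ i < w.countP (j < ·) := by
  intro w
  induction w with
  | nil => simp
  | cons a w ih =>
    intro hw i
    have hw' := List.pairwise_cons.1 hw.pairwise
    have ih' := ih hw'.2.sortedGE
    by_cases ha : j < a
    · rw [List.countP_cons_of_pos (by simpa using ha)]
      cases i with
      | zero => simp [ha]
      | succ i => simpa using ih' i
    · have h0 : w.countP (j < ·) = 0 := by
        rw [List.countP_eq_zero]
        intro b hb
        have := hw'.1 b hb
        simp; omega
      rw [List.countP_cons_of_neg (by simpa using ha), h0]
      simp only [Nat.not_lt_zero, iff_false]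
      rintro ⟨h, h'⟩
      have : (a :: w)[i] ≤ a := by
        rcases List.mem_cons.1 (List.getElem_mem h) with h1 | h1
        · exact h1.le
        · exact hw'.1 _ h1
      omega

theorem mem_diagram {n : ℕ} (p : n.Partition) (i j : ℕ) :
    (i, j) ∈ diagram p ↔ i < p.parts.countP (j < ·) := by
  unfold diagram
  rw [YoungDiagram.mem_ofRowLens, lt_countP_iff_of_sortedGE j _ (p.parts.pairwise_sort _).sortedGE]
  conv_rhs => rw [← Multiset.sort_eq p.parts (· ≥ ·), Multiset.coe_countP]

theorem diagram_injective {n : ℕ} : Function.Injective (diagram : n.Partition → YoungDiagram) := by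
  intro p q h
  have h' := congrArg YoungDiagram.rowLens h
  unfold diagram at h'
  rw [YoungDiagram.rowLens_ofRowLens_eq_self, YoungDiagram.rowLens_ofRowLens_eq_self] at h'
  · ext1
    rw [← Multiset.sort_eq p.parts (· ≥ ·), h', Multiset.sort_eq]
  · intro x hx
    exact q.parts_pos ((Multiset.mem_sort _).1 hx)
  · intro x hx
    exact p.parts_pos ((Multiset.mem_sort _).1 hx)

theorem card_cellsOfRowLens (w : List ℕ) : (YoungDiagram.cellsOfRowLens w).card = w.sum := by
  induction w with
  | nil => rfl
  | cons a w ih =>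
    rw [YoungDiagram.cellsOfRowLens, Finset.card_union_of_disjoint]
    · simp [ih]
    · rw [Finset.disjoint_left]
      rintro ⟨i, j⟩ h1 h2
      simp at h1 h2
      omega

theorem card_diagram {n : ℕ} (p : n.Partition) : (diagram p).cells.card = n := by
  unfold diagram YoungDiagram.ofRowLens
  rw [card_cellsOfRowLens, ← Multiset.sum_coe, Multiset.sort_eq, p.parts_sum]

theorem exists_tableau {n : ℕ} (p : n.Partition) {X : Type} [Fintype X]
    (hX : Fintype.card X = n) : Nonempty (Tableau (diagram p) X) :=
  Fintype.card_eq.1 (by simp [card_diagram, hX])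

/-- The number of cells in the first `i` rows. -/
def cellsAbove (μ : YoungDiagram) (i : ℕ) : ℕ := (μ.cells.filter (·.1 < i)).card

theorem eq_of_cellsAbove_eq {μ ν : YoungDiagram} (h : ∀ i, cellsAbove μ i = cellsAbove ν i) :
    μ = ν := by
  have key : ∀ (μ : YoungDiagram) (i : ℕ), cellsAbove μ (i + 1) = cellsAbove μ i + μ.rowLen i := by
    intro μ i
    rw [YoungDiagram.rowLen_eq_card, cellsAbove, cellsAbove, YoungDiagram.row,
      ← Finset.card_union_of_disjoint]
    · congr 1
      ext ⟨a, b⟩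
      simp only [Finset.mem_filter, Finset.mem_union]
      constructor
      · rintro ⟨h1, h2⟩
        rcases Nat.lt_succ_iff_lt_or_eq.1 h2 with h3 | h3
        · exact Or.inl ⟨h1, h3⟩
        · exact Or.inr ⟨h1, h3⟩
      · rintro (⟨h1, h2⟩ | ⟨h1, h2⟩)
        · exact ⟨h1, by simp at h2 ⊢; omega⟩
        · exact ⟨h1, by simp at h2 ⊢; omega⟩
    · rw [Finset.disjoint_left]
      intro a h1 h2
      have := (Finset.mem_filter.1 h1).2
      have := (Finset.mem_filter.1 h2).2
      omega
  ext ⟨i, j⟩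
  have h1 := key μ i
  have h2 := key ν i
  have h3 := h i
  have h4 := h (i + 1)
  have : μ.rowLen i = ν.rowLen i := by omega
  simp [YoungDiagram.mem_iff_lt_rowLen, this]

/-! ### Column antisymmetrizers -/

section Specht

variable {X : Type} [Fintype X] [DecidableEq X] {μ ν : YoungDiagram}

theorem Tableau.ext_row_col (t : Tableau μ X) {x y : X} (h1 : t.row x = t.row y)
    (h2 : t.col x = t.col y) : x = y :=
  t.symm.injective (Subtype.ext (Prod.ext h1 h2))

theorem Tableau.row_trans (t : Tableau μ X) (g : Equiv.Perm X) :
    Tableau.row (t.trans g) = t.row ∘ ⇑g⁻¹ := rfl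

theorem Tableau.mem (t : Tableau μ X) (x : X) : (t.row x, t.col x) ∈ μ :=
  (YoungDiagram.mem_cells _).1 (t.symm x).2

theorem Tableau.exists_cell (t : Tableau μ X) {i j : ℕ} (h : (i, j) ∈ μ) :
    ∃ x, t.row x = i ∧ t.col x = j :=
  ⟨t ⟨(i, j), (YoungDiagram.mem_cells _).2 h⟩, by simp [Tableau.row], by simp [Tableau.col]⟩

theorem Tableau.card_row_lt (t : Tableau μ X) (i : ℕ) :
    (Finset.univ.filter fun x => t.row x < i).card = cellsAbove μ i := by
  refine Finset.card_bij (fun x _ => (t.symm x).1) ?_ ?_ ?_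
  · intro x hx
    exact Finset.mem_filter.2 ⟨(t.symm x).2, (Finset.mem_filter.1 hx).2⟩
  · intro x _ y _ h
    exact t.symm.injective (Subtype.ext h)
  · intro c hc
    obtain ⟨h1, h2⟩ := Finset.mem_filter.1 hc
    exact ⟨t ⟨c, h1⟩, Finset.mem_filter.2 ⟨Finset.mem_univ _, by simpa [Tableau.row] using h2⟩, by simp⟩

/-- The permutations that preserve every column of `t`. -/
def columnGroup (t : Tableau μ X) : Finset (Equiv.Perm X) :=
  Finset.univ.filter fun π => ∀ x, t.col (π x) = t.col x

theorem mem_columnGroup {t : Tableau μ X} {π : Equiv.Perm X} :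
    π ∈ columnGroup t ↔ ∀ x, t.col (π x) = t.col x := by
  simp [columnGroup]

theorem one_mem_columnGroup (t : Tableau μ X) : 1 ∈ columnGroup t := by
  simp [mem_columnGroup]

theorem mul_mem_columnGroup {t : Tableau μ X} {π ρ : Equiv.Perm X} (hπ : π ∈ columnGroup t)
    (hρ : ρ ∈ columnGroup t) : π * ρ ∈ columnGroup t := by
  rw [mem_columnGroup] at *
  intro x
  rw [Equiv.Perm.mul_apply, hπ, hρ]

theorem inv_mem_columnGroup {t : Tableau μ X} {π : Equiv.Perm X} (hπ : π ∈ columnGroup t) :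
    π⁻¹ ∈ columnGroup t := by
  rw [mem_columnGroup] at *
  intro x
  simpa using (hπ (π⁻¹ x)).symm

theorem swap_mem_columnGroup {t : Tableau μ X} {x y : X} (h : t.col x = t.col y) :
    Equiv.swap x y ∈ columnGroup t := by
  rw [mem_columnGroup]
  intro z
  rw [Equiv.swap_apply_def]
  split_ifs with h1 h2
  · rw [h1, h]
  · rw [h2, h]
  · rfl

/-- The sign of a permutation as a complex number. -/
def csign (π : Equiv.Perm X) : ℂ := ((Equiv.Perm.sign π : ℤ) : ℂ)

theorem csign_mul (π ρ : Equiv.Perm X) : csign (π * ρ) = csign π * csign ρ := by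
  simp [csign]

theorem csign_mul_self (π : Equiv.Perm X) : csign π * csign π = 1 := by
  rcases Int.units_eq_one_or (Equiv.Perm.sign π) with h | h <;> simp [csign, h]

/-- The signed sum of the permutations that preserve every column of `t`, acting on the
permutation module. -/
def columnAntisymmetrizer (t : Tableau μ X) : ((X → ℕ) →₀ ℂ) →ₗ[ℂ] ((X → ℕ) →₀ ℂ) :=
  ∑ π ∈ columnGroup t, csign π • tabloidRep X π

theorem tabloidRep_single (g : Equiv.Perm X) (f : X → ℕ) (c : ℂ) :
    tabloidRep X g (Finsupp.single f c) = Finsupp.single (f ∘ ⇑g⁻¹) c := by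
  simp [tabloidRep, Finsupp.lmapDomain_apply]

theorem columnAntisymmetrizer_single_row (t : Tableau μ X) :
    columnAntisymmetrizer t (Finsupp.single t.row 1) = polytabloid t := by
  simp [columnAntisymmetrizer, LinearMap.sum_apply, tabloidRep_single, polytabloid, columnGroup,
    csign]

theorem columnAntisymmetrizer_tabloidRep (t : Tableau μ X) {ρ : Equiv.Perm X}
    (hρ : ρ ∈ columnGroup t) (v : (X → ℕ) →₀ ℂ) :
    columnAntisymmetrizer t (tabloidRep X ρ v) = csign ρ • columnAntisymmetrizer t v := by
  simp only [columnAntisymmetrizer, LinearMap.sum_apply, LinearMap.smul_apply, Finset.smul_sum]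
  refine Finset.sum_bij' (fun π _ => π * ρ) (fun π _ => π * ρ⁻¹) ?_ ?_ ?_ ?_ ?_
  · intro π hπ
    exact mul_mem_columnGroup hπ hρ
  · intro π hπ
    exact mul_mem_columnGroup hπ (inv_mem_columnGroup hρ)
  · intro π _
    simp
  · intro π _
    simp
  · intro π _
    rw [map_mul, Module.End.mul_apply, smul_smul, csign_mul, mul_comm (csign π), ← mul_assoc,
      csign_mul_self, one_mul]

theorem tabloidRep_columnAntisymmetrizer (t : Tableau μ X) {ρ : Equiv.Perm X}
    (hρ : ρ ∈ columnGroup t) (v : (X → ℕ) →₀ ℂ) :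
    tabloidRep X ρ (columnAntisymmetrizer t v) = csign ρ • columnAntisymmetrizer t v := by
  simp only [columnAntisymmetrizer, LinearMap.sum_apply, LinearMap.smul_apply, Finset.smul_sum,
    map_sum, map_smul]
  refine Finset.sum_bij' (fun π _ => ρ * π) (fun π _ => ρ⁻¹ * π) ?_ ?_ ?_ ?_ ?_
  · intro π hπ
    exact mul_mem_columnGroup hρ hπ
  · intro π hπ
    exact mul_mem_columnGroup (inv_mem_columnGroup hρ) hπ
  · intro π _
    simp
  · intro π _
    simp
  · intro π _
    rw [map_mul, Module.End.mul_apply, smul_smul, csign_mul, ← mul_assoc,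
      csign_mul_self, one_mul]

theorem columnAntisymmetrizer_polytabloid (t : Tableau μ X) :
    columnAntisymmetrizer t (polytabloid t) = ((columnGroup t).card : ℂ) • polytabloid t := by
  conv_lhs => rw [columnAntisymmetrizer, LinearMap.sum_apply]
  rw [Finset.sum_congr rfl (g := fun _ => polytabloid t)]
  · rw [Finset.sum_const, Nat.cast_smul_eq_nsmul]
  · intro π hπ
    rw [LinearMap.smul_apply, ← columnAntisymmetrizer_single_row,
      tabloidRep_columnAntisymmetrizer t hπ, smul_smul, csign_mul_self, one_smul]

theorem card_columnGroup_ne_zero (t : Tableau μ X) : ((columnGroup t).card : ℂ) ≠ 0 :=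
  Nat.cast_ne_zero.2 (Finset.card_ne_zero.2 ⟨1, one_mem_columnGroup t⟩)

theorem columnAntisymmetrizer_single_eq_zero (t : Tableau μ X) {f : X → ℕ} {x y : X} (hxy : x ≠ y)
    (hcol : t.col x = t.col y) (hf : f x = f y) :
    columnAntisymmetrizer t (Finsupp.single f 1) = 0 := by
  have h1 : tabloidRep X (Equiv.swap x y) (Finsupp.single f 1) = Finsupp.single f 1 := by
    rw [tabloidRep_single, Equiv.swap_inv]
    congr 1
    funext z
    rw [Function.comp_apply, Equiv.swap_apply_def]
    split_ifs with h1 h2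
    · rw [h1, hf]
    · rw [h2, hf]
    · rfl
  have h2 := columnAntisymmetrizer_tabloidRep t (swap_mem_columnGroup hcol) (Finsupp.single f 1)
  rw [h1, csign, Equiv.Perm.sign_swap hxy] at h2
  have h3 : columnAntisymmetrizer t (Finsupp.single f 1)
      = -columnAntisymmetrizer t (Finsupp.single f 1) := by simpa using h2
  exact self_eq_neg.1 h3

/-- If `f` is injective on the columns of `t`, then a column has at most as many entries with
`f x < i` as it has entries in the first `i` rows. -/
theorem card_col_lt_le (t : Tableau μ X) {f : X → ℕ}
    (hf : ∀ x y, t.col x = t.col y → f x = f y → x = y) (i c : ℕ) :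
    (Finset.univ.filter fun x => t.col x = c ∧ f x < i).card ≤
      (Finset.univ.filter fun x => t.col x = c ∧ t.row x < i).card := by
  by_cases h : ∃ x, t.col x = c ∧ i ≤ t.row x
  · obtain ⟨x, hx, hi⟩ := h
    trans (Finset.range i).card
    · refine Finset.card_le_card_of_injOn f ?_ ?_
      · intro y hy
        simpa using (Finset.mem_filter.1 hy).2.2
      · intro y hy z hz hyz
        have hy' := (Finset.mem_filter.1 hy).2.1
        have hz' := (Finset.mem_filter.1 hz).2.1
        exact hf _ _ (hy'.trans hz'.symm) hyz
    · refine Finset.card_le_card_of_surjOn t.row ?_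
      intro j hj
      have hj' : j < i := by simpa using hj
      have hm : (j, c) ∈ μ := by
        rw [← hx]
        exact μ.up_left_mem (hj'.le.trans hi) le_rfl (t.mem x)
      obtain ⟨y, hy1, hy2⟩ := t.exists_cell hm
      exact ⟨y, by simp [hy1, hy2, hj'], hy1⟩
  · push Not at h
    refine Finset.card_le_card ?_
    intro x hx
    have := (Finset.mem_filter.1 hx).2
    simp only [Finset.mem_filter, Finset.mem_univ, true_and]
    exact ⟨this.1, h x this.1⟩

theorem card_filter_lt_eq_sum (t : Tableau μ X) (f : X → ℕ) (i : ℕ) :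
    (Finset.univ.filter fun x => f x < i).card =
      ∑ c ∈ Finset.univ.image t.col, (Finset.univ.filter fun x => t.col x = c ∧ f x < i).card := by
  rw [Finset.card_eq_sum_card_fiberwise (f := t.col) (t := Finset.univ.image t.col)]
  · refine Finset.sum_congr rfl fun c _ => ?_
    rw [Finset.filter_filter]
    congr 1
    ext x
    simp [and_comm]
  · intro x _
    simp

theorem card_lt_le_cellsAbove (t : Tableau μ X) {f : X → ℕ}
    (hf : ∀ x y, t.col x = t.col y → f x = f y → x = y) (i : ℕ) :
    (Finset.univ.filter fun x => f x < i).card ≤ cellsAbove μ i := by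
  rw [← t.card_row_lt, card_filter_lt_eq_sum t, card_filter_lt_eq_sum t]
  exact Finset.sum_le_sum fun c _ => card_col_lt_le t hf i c

theorem exists_columnGroup_of_card_eq (t : Tableau μ X) {f : X → ℕ}
    (hf : ∀ x y, t.col x = t.col y → f x = f y → x = y)
    (hcard : ∀ i, (Finset.univ.filter fun x => f x < i).card = cellsAbove μ i) :
    ∃ π ∈ columnGroup t, f = t.row ∘ ⇑π⁻¹ := by
  have hcol : ∀ i c, (Finset.univ.filter fun x => t.col x = c ∧ f x < i).card =
      (Finset.univ.filter fun x => t.col x = c ∧ t.row x < i).card := by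
    intro i c
    by_cases hc : c ∈ Finset.univ.image t.col
    · have h1 := hcard i
      rw [← t.card_row_lt, card_filter_lt_eq_sum t, card_filter_lt_eq_sum t] at h1
      exact (Finset.sum_eq_sum_iff_of_le fun c _ => card_col_lt_le t hf i c).1 h1 c hc
    · have : ∀ x, t.col x ≠ c := fun x hx => hc (by simp [← hx])
      simp [this]
  have hex : ∀ x, ∃ y, t.col y = t.col x ∧ f y = t.row x := by
    intro x
    by_contra hne
    push Not at hne
    have h1 := hcol (t.row x) (t.col x)
    have h2 := hcol (t.row x + 1) (t.col x)
    have h3 : (Finset.univ.filter fun y => t.col y = t.col x ∧ f y < t.row x + 1) =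
        Finset.univ.filter fun y => t.col y = t.col x ∧ f y < t.row x := by
      ext y
      simp only [Finset.mem_filter, Finset.mem_univ, true_and]
      refine and_congr_right fun hy => ?_
      have := hne y hy
      omega
    have h4 : (Finset.univ.filter fun y => t.col y = t.col x ∧ t.row y < t.row x).card <
        (Finset.univ.filter fun y => t.col y = t.col x ∧ t.row y < t.row x + 1).card := by
      refine Finset.card_lt_card ⟨?_, ?_⟩
      · intro y
        simp only [Finset.mem_filter, Finset.mem_univ, true_and]
        omega
      · intro hsub
        have := @hsub x (by simp)
        simp at this
    rw [h3] at h2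
    omega
  choose σ hσ1 hσ2 using hex
  have hinj : Function.Injective σ := by
    intro x y hxy
    refine t.ext_row_col ?_ ?_
    · rw [← hσ2, ← hσ2, hxy]
    · rw [← hσ1 x, ← hσ1 y, hxy]
  refine ⟨Equiv.ofBijective σ (Finite.injective_iff_bijective.1 hinj), ?_, ?_⟩
  · rw [mem_columnGroup]
    exact hσ1
  · funext x
    obtain ⟨y, rfl⟩ := (Equiv.ofBijective σ (Finite.injective_iff_bijective.1 hinj)).surjective x
    simp [hσ2]

theorem columnAntisymmetrizer_single_row_dominance (t : Tableau μ X) (s : Tableau ν X)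
    (h : columnAntisymmetrizer t (Finsupp.single s.row 1) ≠ 0) (i : ℕ) :
    cellsAbove ν i ≤ cellsAbove μ i := by
  rw [← s.card_row_lt]
  refine card_lt_le_cellsAbove t ?_ i
  intro x y hxy hrow
  by_contra hne
  exact h (columnAntisymmetrizer_single_eq_zero t hne hxy hrow)

theorem columnAntisymmetrizer_single_row_mem_span (t s : Tableau μ X) :
    columnAntisymmetrizer t (Finsupp.single s.row 1) ∈ Submodule.span ℂ {polytabloid t} := by
  by_cases h : ∀ x y, t.col x = t.col y → s.row x = s.row y → x = y
  · obtain ⟨π, hπ, hs⟩ := exists_columnGroup_of_card_eq t h s.card_row_lt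
    rw [hs, ← tabloidRep_single, columnAntisymmetrizer_tabloidRep t hπ,
      columnAntisymmetrizer_single_row]
    exact Submodule.smul_mem _ _ (Submodule.mem_span_singleton_self _)
  · push Not at h
    obtain ⟨x, y, h1, h2, h3⟩ := h
    rw [columnAntisymmetrizer_single_eq_zero t h3 h1 h2]
    exact Submodule.zero_mem _

theorem spechtSub_le_span_row (ν : YoungDiagram) :
    (spechtSub ν X).toSubmodule ≤
      Submodule.span ℂ (Set.range fun s : Tableau ν X => Finsupp.single s.row (1 : ℂ)) := by
  refine Submodule.span_le.2 ?_
  rintro _ ⟨s, rfl⟩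
  refine Submodule.sum_mem _ fun π _ => ?_
  rw [← Tableau.row_trans, ← mul_one ((Equiv.Perm.sign π : ℤ) : ℂ), ← smul_eq_mul,
    ← Finsupp.smul_single]
  exact Submodule.smul_mem _ _ (Submodule.subset_span ⟨_, rfl⟩)

theorem columnAntisymmetrizer_mem_span (t : Tableau μ X) {v : (X → ℕ) →₀ ℂ}
    (hv : v ∈ (spechtSub μ X).toSubmodule) :
    columnAntisymmetrizer t v ∈ Submodule.span ℂ {polytabloid t} := by
  replace hv := spechtSub_le_span_row μ hv
  induction hv using Submodule.span_induction with
  | mem v hv =>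
    obtain ⟨s, rfl⟩ := hv
    exact columnAntisymmetrizer_single_row_mem_span t s
  | zero => rw [map_zero]; exact Submodule.zero_mem _
  | add v w _ _ hv hw => rw [map_add]; exact Submodule.add_mem _ hv hw
  | smul c v _ hv => rw [map_smul]; exact Submodule.smul_mem _ c hv

theorem dominance_of_columnAntisymmetrizer_ne_zero (t : Tableau μ X) {v : (X → ℕ) →₀ ℂ}
    (hv : v ∈ (spechtSub ν X).toSubmodule) (h : columnAntisymmetrizer t v ≠ 0) (i : ℕ) :
    cellsAbove ν i ≤ cellsAbove μ i := by
  by_contra hlt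
  refine h ?_
  clear h
  replace hv := spechtSub_le_span_row ν hv
  induction hv using Submodule.span_induction with
  | mem v hv =>
    obtain ⟨s, rfl⟩ := hv
    by_contra hne
    exact hlt (columnAntisymmetrizer_single_row_dominance t s hne i)
  | zero => rw [map_zero]
  | add v w _ _ hv hw => rw [map_add, hv, hw, add_zero]
  | smul c v _ hv => rw [map_smul, hv, smul_zero]

theorem polytabloid_ne_zero (t : Tableau μ X) : polytabloid t ≠ 0 := by
  intro h
  have h1 : polytabloid t t.row = 1 := by
    rw [polytabloid, Finsupp.finsetSum_apply, Finset.sum_eq_single 1]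
    · simp
    · intro π hπ hne
      rw [Finsupp.single_apply, if_neg]
      intro hrow
      refine hne (Equiv.ext fun x => t.ext_row_col ?_ ((Finset.mem_filter.1 hπ).2 x))
      have := congrFun hrow (π x)
      simpa using this.symm
    · simp
  rw [h] at h1
  simp at h1

end Specht

/-! ### The inner product of complex functions on a finite group -/

section Inner

variable {G : Type*} [Group G] [Fintype G]

/-- The bilinear form on functions for which the characters of a finite group are orthonormal. -/
def cfInner (u v : G → ℂ) : ℂ := (Nat.card G : ℂ)⁻¹ * ∑ g, u g * v g⁻¹

theorem cfInner_comm (u v : G → ℂ) : cfInner u v = cfInner v u := by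
  unfold cfInner
  congr 1
  refine Fintype.sum_equiv (Equiv.inv G) _ _ fun g => ?_
  simp [mul_comm]

theorem cfInner_sub_left (u u' v : G → ℂ) :
    cfInner (u - u') v = cfInner u v - cfInner u' v := by
  simp [cfInner, sub_mul, mul_sub]

theorem cfInner_smul_left (c : ℂ) (u v : G → ℂ) : cfInner (c • u) v = c * cfInner u v := by
  simp only [cfInner, Pi.smul_apply, smul_eq_mul, mul_assoc, ← Finset.mul_sum]
  ring

theorem cfInner_sum_left {ι : Type*} (s : Finset ι) (u : ι → G → ℂ) (v : G → ℂ) :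
    cfInner (∑ i ∈ s, u i) v = ∑ i ∈ s, cfInner (u i) v := by
  simp only [cfInner, Finset.sum_apply, Finset.sum_mul, Finset.mul_sum]
  rw [Finset.sum_comm]

theorem cfInner_character {V W : Type*} [AddCommGroup V] [Module ℂ V] [FiniteDimensional ℂ V]
    [AddCommGroup W] [Module ℂ W] [FiniteDimensional ℂ W]
    (ρ : Representation ℂ G V) (σ : Representation ℂ G W) :
    cfInner σ.character ρ.character = Module.finrank ℂ (Representation.IntertwiningMap ρ σ) := by
  have : Invertible (Nat.card G : ℂ) := invertibleOfNonzero (Nat.cast_ne_zero.2 Nat.card_pos.ne')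
  exact Representation.card_inv_mul_sum_char_mul_char_eq_finrank ρ σ

theorem finrank_intertwiningMap_comm {V W : Type*} [AddCommGroup V] [Module ℂ V]
    [FiniteDimensional ℂ V] [AddCommGroup W] [Module ℂ W] [FiniteDimensional ℂ W]
    (ρ : Representation ℂ G V) (σ : Representation ℂ G W) :
    Module.finrank ℂ (Representation.IntertwiningMap ρ σ) =
      Module.finrank ℂ (Representation.IntertwiningMap σ ρ) := by
  have := cfInner_comm σ.character ρ.character
  rw [cfInner_character, cfInner_character] at this
  exact_mod_cast this

instance finiteDimensional_intertwiningMap {V W : Type*} [AddCommGroup V] [Module ℂ V]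
    [FiniteDimensional ℂ V] [AddCommGroup W] [Module ℂ W] [FiniteDimensional ℂ W]
    (ρ : Representation ℂ G V) (σ : Representation ℂ G W) :
    FiniteDimensional ℂ (Representation.IntertwiningMap ρ σ) :=
  Module.Finite.equiv (Representation.invariantsEquivIntertwiningMap ρ σ)

end Inner

/-! ### Orthonormality of the characters of the Specht modules -/

section Specht

variable {X : Type} [Fintype X] [DecidableEq X]

instance finiteDimensional_spechtModule {n : ℕ} (p : n.Partition) :
    FiniteDimensional ℂ (SpechtModule p X) :=
  FiniteDimensional.span_of_finite ℂ (Set.finite_range _)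

/-- The polytabloid of `t` as an element of the Specht module. -/
def spechtPolytabloid {n : ℕ} {p : n.Partition} (t : Tableau (diagram p) X) : SpechtModule p X :=
  ⟨polytabloid t, Submodule.subset_span ⟨t, rfl⟩⟩

/-- The inclusion of the Specht module into the permutation module. -/
def spechtIncl {n : ℕ} (p : n.Partition) (X : Type) [Fintype X] [DecidableEq X] :
    SpechtModule p X →ₗ[ℂ] ((X → ℕ) →₀ ℂ) := (spechtSub (diagram p) X).toSubmodule.subtype

theorem spechtIncl_injective {n : ℕ} (p : n.Partition) : Function.Injective (spechtIncl p X) :=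
  Subtype.val_injective

theorem spechtIncl_specht {n : ℕ} (p : n.Partition) (g : Equiv.Perm X) (v : SpechtModule p X) :
    spechtIncl p X (specht p X g v) = tabloidRep X g (spechtIncl p X v) := rfl

theorem spechtIncl_mem {n : ℕ} (p : n.Partition) (v : SpechtModule p X) :
    spechtIncl p X v ∈ (spechtSub (diagram p) X).toSubmodule := v.2

theorem specht_spechtPolytabloid {n : ℕ} {p : n.Partition} (g : Equiv.Perm X)
    (t : Tableau (diagram p) X) :
    specht p X g (spechtPolytabloid t) = spechtPolytabloid (t.trans g) :=
  spechtIncl_injective p (tabloidRep_polytabloid g t)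

theorem span_spechtPolytabloid {n : ℕ} (p : n.Partition) :
    Submodule.span ℂ (Set.range (spechtPolytabloid : Tableau (diagram p) X → SpechtModule p X)) =
      ⊤ := by
  refine Submodule.map_injective_of_injective (spechtIncl_injective p (X := X)) ?_
  rw [Submodule.map_span, ← Set.range_comp, Submodule.map_top]
  exact (Submodule.range_subtype _).symm

variable {V : Type*} [AddCommGroup V] [Module ℂ V] {ρ : Representation ℂ (Equiv.Perm X) V}

theorem eq_zero_of_apply_spechtPolytabloid {n : ℕ} {p : n.Partition} (t : Tableau (diagram p) X)
    (θ : Representation.IntertwiningMap (specht p X) ρ) (h : θ (spechtPolytabloid t) = 0) :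
    θ = 0 := by
  refine Representation.IntertwiningMap.ext (LinearMap.ext_on_range (span_spechtPolytabloid p) ?_)
  intro s
  have hs : s = t.trans (t.symm.trans s) := by ext; simp
  rw [hs, ← specht_spechtPolytabloid, Representation.IntertwiningMap.toLinearMap_apply,
    θ.isIntertwining, h, map_zero]
  rfl

theorem columnAntisymmetrizer_apply_intertwining {n m : ℕ} {p : n.Partition} {q : m.Partition}
    (t : Tableau (diagram p) X)
    (θ : Representation.IntertwiningMap (specht p X) (specht q X)) :
    columnAntisymmetrizer t (spechtIncl q X (θ (spechtPolytabloid t))) =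
      ((columnGroup t).card : ℂ) • spechtIncl q X (θ (spechtPolytabloid t)) := by
  have h1 : ∑ π ∈ columnGroup t, csign π • specht p X π (spechtPolytabloid t) =
      ((columnGroup t).card : ℂ) • spechtPolytabloid t := by
    refine spechtIncl_injective p ?_
    rw [map_smul, map_sum]
    refine Eq.trans ?_ (columnAntisymmetrizer_polytabloid t)
    rw [columnAntisymmetrizer, LinearMap.sum_apply]
    exact Finset.sum_congr rfl fun π _ => by
      rw [map_smul, spechtIncl_specht]
      rfl
  have h2 := congrArg (fun v => spechtIncl q X (θ v)) h1
  simp only [map_sum, map_smul, θ.isIntertwining, spechtIncl_specht] at h2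
  rw [← h2, columnAntisymmetrizer, LinearMap.sum_apply]
  rfl

theorem finrank_intertwiningMap_specht_self {n : ℕ} (p : n.Partition)
    (hX : Fintype.card X = n) :
    Module.finrank ℂ (Representation.IntertwiningMap (specht p X) (specht p X)) = 1 := by
  obtain ⟨t⟩ := exists_tableau p hX
  have hne : Representation.IntertwiningMap.id (specht p X) ≠ 0 := by
    intro h
    have h1 : Representation.IntertwiningMap.id (specht p X) (spechtPolytabloid t) = 0 := by
      rw [h]; rfl
    exact polytabloid_ne_zero t (congrArg (spechtIncl p X) h1)
  rw [finrank_eq_one_iff_of_nonzero' _ hne]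
  intro θ
  have h1 := columnAntisymmetrizer_apply_intertwining t θ
  have h2 := columnAntisymmetrizer_mem_span t (spechtIncl_mem p (θ (spechtPolytabloid t)))
  obtain ⟨c, hc⟩ := Submodule.mem_span_singleton.1 h2
  rw [h1] at hc
  refine ⟨((columnGroup t).card : ℂ)⁻¹ * c, ?_⟩
  rw [← sub_eq_zero]
  refine eq_zero_of_apply_spechtPolytabloid t _ ?_
  refine spechtIncl_injective p ?_
  have h3 : spechtIncl p X (θ (spechtPolytabloid t)) =
      (((columnGroup t).card : ℂ)⁻¹ * c) • polytabloid t := by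
    rw [mul_smul, hc, smul_smul, inv_mul_cancel₀ (card_columnGroup_ne_zero t), one_smul]
  change (((columnGroup t).card : ℂ)⁻¹ * c) • polytabloid t -
    spechtIncl p X (θ (spechtPolytabloid t)) = 0
  rw [h3, sub_self]

theorem cellsAbove_le_of_finrank_ne_zero {n m : ℕ} (p : n.Partition) (q : m.Partition)
    (hX : Fintype.card X = n)
    (h : Module.finrank ℂ (Representation.IntertwiningMap (specht p X) (specht q X)) ≠ 0) (i : ℕ) :
    cellsAbove (diagram q) i ≤ cellsAbove (diagram p) i := by
  obtain ⟨t⟩ := exists_tableau p hX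
  have : Nontrivial (Representation.IntertwiningMap (specht p X) (specht q X)) :=
    Module.nontrivial_of_finrank_pos (Nat.pos_of_ne_zero h)
  obtain ⟨θ, hθ⟩ := exists_ne (0 : Representation.IntertwiningMap (specht p X) (specht q X))
  refine dominance_of_columnAntisymmetrizer_ne_zero t
    (spechtIncl_mem q (θ (spechtPolytabloid t))) ?_ i
  rw [columnAntisymmetrizer_apply_intertwining]
  intro h0
  refine hθ (eq_zero_of_apply_spechtPolytabloid t θ (spechtIncl_injective q ?_))
  rw [map_zero]
  exact (smul_eq_zero.1 h0).resolve_left (card_columnGroup_ne_zero t)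

theorem cfInner_chi {n : ℕ} (p q : n.Partition) (hX : Fintype.card X = n) :
    cfInner (chi p X) (chi q X) = if p = q then 1 else 0 := by
  unfold chi
  rw [cfInner_character]
  split_ifs with h
  · subst h
    rw [finrank_intertwiningMap_specht_self p hX, Nat.cast_one]
  · rw [Nat.cast_eq_zero]
    by_contra hne
    refine h (diagram_injective (eq_of_cellsAbove_eq fun i => le_antisymm ?_ ?_))
    · exact cellsAbove_le_of_finrank_ne_zero q p hX hne i
    · rw [finrank_intertwiningMap_comm] at hne
      exact cellsAbove_le_of_finrank_ne_zero p q hX hne i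

theorem eq_sum_cfInner_chi {n : ℕ} (hX : Fintype.card X = n) (u : Equiv.Perm X → ℂ)
    (hu : ∀ g h, u (h * g * h⁻¹) = u g) :
    u = ∑ p : n.Partition, cfInner u (chi p X) • chi p X := by
  classical
  let D : ((Fintype.card X).Partition → ℂ) →ₗ[ℂ] (Equiv.Perm X → ℂ) :=
    LinearMap.funLeft ℂ ℂ Equiv.Perm.partition
  have hclass : ∀ v : Equiv.Perm X → ℂ, (∀ g h, v (h * g * h⁻¹) = v g) →
      v ∈ LinearMap.range D := by
    intro v hv
    refine ⟨Function.extend Equiv.Perm.partition v 0, funext fun g => ?_⟩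
    refine Function.FactorsThrough.extend_apply (f := Equiv.Perm.partition) ?_ 0 g
    intro a b hab
    obtain ⟨c, rfl⟩ := isConj_iff.1 (Equiv.Perm.partition_eq_of_isConj.2 hab)
    exact (hv a c).symm
  have hind : LinearIndependent ℂ fun p : n.Partition => chi p X := by
    rw [Fintype.linearIndependent_iff]
    intro c hc p
    have h1 := congrArg (fun v => cfInner v (chi p X)) hc
    simp only [cfInner_sum_left, cfInner_smul_left, cfInner_chi _ _ hX] at h1
    simpa [cfInner] using h1
  have hspan : Submodule.span ℂ (Set.range fun p : n.Partition => chi p X) =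
      LinearMap.range D := by
    refine Submodule.eq_of_le_of_finrank_le (Submodule.span_le.2 ?_) ?_
    · rintro _ ⟨p, rfl⟩
      exact hclass _ fun g h => Representation.char_conj _ g h
    · rw [finrank_span_eq_card hind]
      refine (LinearMap.finrank_range_le D).trans ?_
      rw [Module.finrank_fintype_fun_eq_card]
      subst hX
      exact le_of_eq (Fintype.card_congr (Equiv.refl _))
  obtain ⟨c, hc⟩ := (Submodule.mem_span_range_iff_exists_fun ℂ).1 (hspan ▸ hclass u hu)
  rw [← hc]
  refine Finset.sum_congr rfl fun p _ => ?_
  congr 1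
  simp only [cfInner_sum_left, cfInner_smul_left, cfInner_chi _ _ hX]
  simp

theorem character_eq_sum_chi {n : ℕ} (hX : Fintype.card X = n) [FiniteDimensional ℂ V]
    (ρ : Representation ℂ (Equiv.Perm X) V) {ι : Type*} [Fintype ι] (p : ι → n.Partition)
    (hp : Function.Injective p)
    (hhom : ∀ i, ∃ θ : Representation.IntertwiningMap (specht (p i) X) ρ, θ ≠ 0)
    {N : ℕ} (hN : cfInner ρ.character ρ.character = N) (hle : N ≤ Fintype.card ι) :
    ρ.character = ∑ i, chi (p i) X := by
  classical
  set m : n.Partition → ℕ := fun q =>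
    Module.finrank ℂ (Representation.IntertwiningMap (specht q X) ρ) with hm
  have hexp : ρ.character = ∑ q, (m q : ℂ) • chi q X := by
    rw [eq_sum_cfInner_chi hX ρ.character fun g h => Representation.char_conj _ g h]
    refine Finset.sum_congr rfl fun q _ => ?_
    rw [chi, cfInner_character]
  have hsq : ∑ q, m q * m q = N := by
    have h1 : cfInner ρ.character ρ.character = ∑ q, (m q : ℂ) * m q := by
      conv_lhs => rw [hexp]
      rw [cfInner_sum_left]
      refine Finset.sum_congr rfl fun q _ => ?_
      rw [cfInner_smul_left, cfInner_comm, ← hexp, chi, cfInner_character]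
    rw [hN] at h1
    exact_mod_cast h1.symm
  have hpos : ∀ i, 1 ≤ m (p i) := by
    intro i
    obtain ⟨θ, hθ⟩ := hhom i
    have : Nontrivial (Representation.IntertwiningMap (specht (p i) X) ρ) := ⟨θ, 0, hθ⟩
    exact Module.finrank_pos
  have hind : ∀ q, (if q ∈ Finset.univ.image p then 1 else 0) ≤ m q * m q := by
    intro q
    split_ifs with hq
    · obtain ⟨i, _, rfl⟩ := Finset.mem_image.1 hq
      exact Nat.mul_le_mul (hpos i) (hpos i)
    · exact Nat.zero_le _
  have hsum : ∑ q : n.Partition, (if q ∈ Finset.univ.image p then 1 else 0) =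
      Fintype.card ι := by
    rw [Finset.sum_boole, Nat.cast_id, ← Finset.card_univ, ← Finset.card_image_of_injective _ hp]
    congr 1
    ext q
    simp
  have heq := (Finset.sum_eq_sum_iff_of_le fun q _ => hind q).1
    (le_antisymm (Finset.sum_le_sum fun q _ => hind q) (by rw [hsum, hsq]; exact hle))
  have hmq : ∀ q, m q = if q ∈ Finset.univ.image p then 1 else 0 := by
    intro q
    have := heq q (Finset.mem_univ q)
    split_ifs at this ⊢ with hq
    · exact Nat.dvd_one.1 ⟨m q, this⟩
    · simpa using this.symm
  rw [hexp]
  simp only [hmq, Nat.cast_ite, Nat.cast_one, Nat.cast_zero, ite_smul, one_smul, zero_smul]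
  rw [← Finset.sum_filter, Finset.filter_mem_eq_inter, Finset.univ_inter,
    Finset.sum_image fun a _ b _ h => hp h]

end Specht

/-! ### Permutation characters -/

section Perm

variable {G : Type*} [Group G] [Fintype G] {Ω : Type*} [Fintype Ω] [MulAction G Ω]

/-- The representation on the functions on a `G`-set. -/
def permRep (G : Type*) [Group G] (Ω : Type*) [MulAction G Ω] : Representation ℂ G (Ω → ℂ) where
  toFun g := LinearMap.funLeft ℂ ℂ fun ω => g⁻¹ • ω
  map_one' := by
    ext
    simp [LinearMap.funLeft]
  map_mul' g h := by
    refine LinearMap.ext fun F => funext fun ω => ?_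
    simp [LinearMap.funLeft, mul_smul]

theorem permRep_apply (g : G) (F : Ω → ℂ) (ω : Ω) : permRep G Ω g F ω = F (g⁻¹ • ω) := rfl

theorem character_permRep (g : G) :
    (permRep G Ω).character g = Nat.card (MulAction.fixedBy Ω g) := by
  classical
  rw [Representation.character, LinearMap.trace_eq_matrix_trace ℂ (Pi.basisFun ℂ Ω), Matrix.trace]
  simp only [Matrix.diag, LinearMap.toMatrix_apply, Pi.basisFun_apply, Pi.basisFun_repr,
    permRep_apply, Pi.single_apply]
  rw [Finset.sum_boole, Nat.card_eq_fintype_card, Fintype.card_subtype]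
  congr 2
  ext ω
  simp only [Finset.mem_filter, Finset.mem_univ, true_and, MulAction.mem_fixedBy]
  rw [inv_smul_eq_iff, eq_comm]

theorem cfInner_permRep :
    cfInner (permRep G Ω).character (permRep G Ω).character =
      Nat.card (MulAction.orbitRel.Quotient G (Ω × Ω)) := by
  classical
  have h1 := MulAction.sum_card_fixedBy_eq_card_orbits_mul_card_group G (Ω × Ω)
  have h2 : ∀ g : G, (permRep G Ω).character g * (permRep G Ω).character g⁻¹ =
      (Fintype.card (MulAction.fixedBy (Ω × Ω) g) : ℂ) := by
    intro g
    rw [character_permRep, character_permRep, MulAction.fixedBy_inv, ← Nat.cast_mul,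
      ← Nat.card_prod, ← Nat.card_eq_fintype_card]
    congr 1
    refine Nat.card_congr ⟨fun a => ⟨(a.1.1, a.2.1), Prod.ext a.1.2 a.2.2⟩,
      fun a => (⟨a.1.1, congrArg Prod.fst a.2⟩, ⟨a.1.2, congrArg Prod.snd a.2⟩),
      fun a => rfl, fun a => rfl⟩
  unfold cfInner
  simp only [h2]
  rw [← Nat.cast_sum, h1, Nat.cast_mul, mul_comm, mul_assoc, ← Nat.card_eq_fintype_card (α := G),
    mul_inv_cancel₀ (Nat.cast_ne_zero.2 Nat.card_pos.ne'), mul_one, Nat.card_eq_fintype_card]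

end Perm

section Specht

variable {X : Type} [Fintype X] [DecidableEq X] {Ω : Type*} [Fintype Ω]
  [MulAction (Equiv.Perm X) Ω]

open Classical in
/-- The linear map from the permutation module on tabloids to the functions on `Ω` given by a
relation between tabloids and elements of `Ω`. -/
def incidenceMap (R : (X → ℕ) → Ω → Prop) : ((X → ℕ) →₀ ℂ) →ₗ[ℂ] (Ω → ℂ) :=
  Finsupp.linearCombination ℂ fun f ω => if R f ω then 1 else 0

theorem incidenceMap_tabloidRep (R : (X → ℕ) → Ω → Prop)
    (hR : ∀ (g : Equiv.Perm X) f ω, R (f ∘ ⇑g⁻¹) (g • ω) ↔ R f ω) (g : Equiv.Perm X) :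
    incidenceMap R ∘ₗ tabloidRep X g = permRep (Equiv.Perm X) Ω g ∘ₗ incidenceMap R := by
  classical
  refine Finsupp.lhom_ext fun f c => funext fun ω => ?_
  have := hR g f (g⁻¹ • ω)
  rw [smul_inv_smul] at this
  simp only [incidenceMap, LinearMap.comp_apply, tabloidRep_single, permRep_apply,
    Finsupp.linearCombination_single, Pi.smul_apply, this]

/-- The restriction of `incidenceMap` to the Specht module. -/
def spechtIncidenceMap (R : (X → ℕ) → Ω → Prop)
    (hR : ∀ (g : Equiv.Perm X) f ω, R (f ∘ ⇑g⁻¹) (g • ω) ↔ R f ω) {n : ℕ} (p : n.Partition) :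
    Representation.IntertwiningMap (specht p X) (permRep (Equiv.Perm X) Ω) where
  toLinearMap := incidenceMap R ∘ₗ spechtIncl p X
  isIntertwining' g := by
    refine LinearMap.ext fun v => ?_
    exact LinearMap.congr_fun (incidenceMap_tabloidRep R hR g) (spechtIncl p X v)

theorem incidenceMap_polytabloid_ne_zero (R : (X → ℕ) → Ω → Prop) {μ : YoungDiagram}
    (t : Tableau μ X) (ω : Ω) (h : R t.row ω)
    (hsign : ∀ π ∈ columnGroup t, R (t.row ∘ ⇑π⁻¹) ω → Equiv.Perm.sign π = 1) :
    incidenceMap R (polytabloid t) ≠ 0 := by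
  classical
  intro h0
  have h1 : incidenceMap R (polytabloid t) ω =
      ((columnGroup t).filter fun π : Equiv.Perm X => R (t.row ∘ ⇑π⁻¹) ω).card := by
    rw [polytabloid, map_sum, Finset.sum_apply, Finset.card_filter, Nat.cast_sum]
    refine Finset.sum_congr rfl fun π hπ => ?_
    simp only [incidenceMap, Finsupp.linearCombination_single, Pi.smul_apply, smul_eq_mul]
    split_ifs with hr
    · rw [hsign π hπ hr]
      simp
    · simp
  rw [h0, Pi.zero_apply, eq_comm, Nat.cast_eq_zero, Finset.card_eq_zero] at h1
  have h2 : (1 : Equiv.Perm X) ∈ (columnGroup t).filter fun π : Equiv.Perm X => R (t.row ∘ ⇑π⁻¹) ω :=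
    Finset.mem_filter.2 ⟨one_mem_columnGroup t, by simpa using h⟩
  rw [h1] at h2
  simp at h2

/-- A criterion for a permutation character to be a multiplicity-free sum of given irreducible
characters: each of them occurs, and there are not more orbits on pairs than characters. -/
theorem card_fixedBy_eq_sum_chi {n : ℕ} (hX : Fintype.card X = n) {ι : Type*} [Fintype ι]
    (p : ι → n.Partition) (hp : Function.Injective p) (R : (X → ℕ) → Ω → Prop)
    (hR : ∀ (g : Equiv.Perm X) f ω, R (f ∘ ⇑g⁻¹) (g • ω) ↔ R f ω)
    (hocc : ∀ i, ∀ t : Tableau (diagram (p i)) X, ∃ ω, R t.row ω ∧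
      ∀ π ∈ columnGroup t, R (t.row ∘ ⇑π⁻¹) ω → Equiv.Perm.sign π = 1)
    (inv : Ω × Ω → ι) (hinv : ∀ a b, inv a = inv b → ∃ g : Equiv.Perm X, g • a = b)
    (g : Equiv.Perm X) :
    (Nat.card (MulAction.fixedBy Ω g) : ℂ) = ∑ i, chi (p i) X g := by
  have h1 : (permRep (Equiv.Perm X) Ω).character = ∑ i, chi (p i) X := by
    refine character_eq_sum_chi hX _ p hp ?_ cfInner_permRep ?_
    · intro i
      obtain ⟨t⟩ := exists_tableau (p i) hX
      obtain ⟨ω, h1, h2⟩ := hocc i t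
      refine ⟨spechtIncidenceMap R hR (p i), fun h0 => ?_⟩
      refine incidenceMap_polytabloid_ne_zero R t ω h1 h2 ?_
      exact congrArg (fun θ => θ (spechtPolytabloid t)) h0
    · rw [← Nat.card_eq_fintype_card]
      refine Nat.card_le_card_of_injective (fun q => inv q.out) fun q q' hq => ?_
      obtain ⟨g, hg⟩ := hinv _ _ hq
      rw [← Quotient.out_eq q, ← Quotient.out_eq q']
      refine Quotient.sound ?_
      exact (MulAction.orbitRel _ _).symm ⟨g, hg⟩
  rw [← character_permRep, h1, Finset.sum_apply]

theorem exists_equiv_comp_eq {α β ι : Type*} [Fintype α] [Fintype β] [DecidableEq ι] (f : α → ι)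
    (g : β → ι) (h : ∀ i, (Finset.univ.filter fun x => f x = i).card =
      (Finset.univ.filter fun x => g x = i).card) :
    ∃ σ : α ≃ β, ∀ x, g (σ x) = f x := by
  have e : ∀ i, Nonempty ({x // f x = i} ≃ {x // g x = i}) := fun i =>
    Fintype.card_eq.1 (by rw [Fintype.card_subtype, Fintype.card_subtype, h i])
  refine ⟨(Equiv.sigmaFiberEquiv f).symm.trans
    ((Equiv.sigmaCongrRight fun i => (e i).some).trans (Equiv.sigmaFiberEquiv g)), fun x => ?_⟩
  exact ((e (f x)).some ⟨x, rfl⟩).2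

end Specht

/-! ### The permutation character on subsets -/

theorem mem_diagram_twoRow {n r : ℕ} (h : 2 * r ≤ n) (i c : ℕ) :
    (i, c) ∈ diagram (twoRow n r h) ↔ (i = 0 ∧ c < n - r) ∨ (i = 1 ∧ c < r) := by
  rw [mem_diagram, twoRow, Nat.Partition.ofSums_parts, Multiset.countP_filter,
    Multiset.insert_eq_cons, Multiset.countP_cons, ← Multiset.cons_zero, Multiset.countP_cons,
    Multiset.countP_zero]
  split_ifs <;> omega

theorem twoRow_injective {n r s : ℕ} (hr : 2 * r ≤ n) (hs : 2 * s ≤ n)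
    (h : twoRow n r hr = twoRow n s hs) : r = s := by
  have key : ∀ c, c < r ↔ c < s := by
    intro c
    have h1 := mem_diagram_twoRow hr 1 c
    rw [h, mem_diagram_twoRow hs 1 c] at h1
    omega
  have h1 := key r
  have h2 := key s
  omega

section Subsets

variable {X : Type} [Fintype X] [DecidableEq X]

/-- The subsets of `X` with `r` elements. -/
abbrev SubsetsOfCard (X : Type) (r : ℕ) : Type := {R : Finset X // R.card = r}

instance (r : ℕ) : MulAction (Equiv.Perm X) (SubsetsOfCard X r) where
  smul g R := ⟨R.1.map g.toEmbedding, by rw [Finset.card_map, R.2]⟩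
  one_smul R := Subtype.ext (Finset.map_refl)
  mul_smul g h R := Subtype.ext (Finset.map_map h.toEmbedding g.toEmbedding R.1).symm

theorem coe_smul_subsetsOfCard {r : ℕ} (g : Equiv.Perm X) (R : SubsetsOfCard X r) :
    (g • R).1 = R.1.map g.toEmbedding := rfl

theorem apply_mem_smul_subsetsOfCard {r : ℕ} (g : Equiv.Perm X) (R : SubsetsOfCard X r) (x : X) :
    g x ∈ (g • R).1 ↔ x ∈ R.1 := by
  simp [coe_smul_subsetsOfCard]

theorem exists_smul_eq_of_card_inter_eq {r : ℕ} (a b : SubsetsOfCard X r × SubsetsOfCard X r)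
    (h : (a.1.1 ∩ a.2.1).card = (b.1.1 ∩ b.2.1).card) : ∃ g : Equiv.Perm X, g • a = b := by
  have hcard : ∀ c : SubsetsOfCard X r × SubsetsOfCard X r, ∀ i : Bool × Bool,
      (Finset.univ.filter fun x => (decide (x ∈ c.1.1), decide (x ∈ c.2.1)) = i).card =
      match i with
      | (true, true) => (c.1.1 ∩ c.2.1).card
      | (true, false) => r - (c.1.1 ∩ c.2.1).card
      | (false, true) => r - (c.1.1 ∩ c.2.1).card
      | (false, false) => Fintype.card X - (r + r - (c.1.1 ∩ c.2.1).card) := by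
    rintro ⟨⟨A, hA⟩, ⟨B, hB⟩⟩ ⟨i, j⟩
    have h1 : ∀ s : Finset X, (∀ x, x ∈ s ↔ (decide (x ∈ A), decide (x ∈ B)) = (i, j)) →
        (Finset.univ.filter fun x => (decide (x ∈ A), decide (x ∈ B)) = (i, j)).card = s.card := by
      intro s hs
      congr 1
      ext x
      simp [hs x]
    match i, j with
    | true, true =>
      rw [h1 (A ∩ B) (by simp)]
    | true, false =>
      rw [h1 (A \ B) (by simp), Finset.card_sdiff, hA, Finset.inter_comm]
    | false, true =>
      rw [h1 (B \ A) (by simp [and_comm]), Finset.card_sdiff, hB]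
    | false, false =>
      rw [h1 (A ∪ B)ᶜ (by simp), Finset.card_compl, Finset.card_union, hA, hB]
  obtain ⟨σ, hσ⟩ := exists_equiv_comp_eq
    (fun x => (decide (x ∈ a.1.1), decide (x ∈ a.2.1)))
    (fun x => (decide (x ∈ b.1.1), decide (x ∈ b.2.1))) (fun i => by
      rw [hcard a, hcard b, h])
  have hσ' : ∀ x, (σ x ∈ b.1.1 ↔ x ∈ a.1.1) ∧ (σ x ∈ b.2.1 ↔ x ∈ a.2.1) := by
    intro x
    simpa using hσ x
  refine ⟨σ, Prod.ext (Subtype.ext (Finset.ext fun x => ?_)) (Subtype.ext (Finset.ext fun x => ?_))⟩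
  · obtain ⟨y, rfl⟩ := σ.surjective x
    rw [(hσ' y).1]
    exact apply_mem_smul_subsetsOfCard σ a.1 y
  · obtain ⟨y, rfl⟩ := σ.surjective x
    rw [(hσ' y).2]
    exact apply_mem_smul_subsetsOfCard σ a.2 y

theorem exists_subset_of_tableau_twoRow {n r j : ℕ} (hX : Fintype.card X = n) (h : 2 * r ≤ n)
    (hj : j ≤ r) (hj' : 2 * j ≤ n) (t : Tableau (diagram (twoRow n j hj')) X) :
    ∃ R : SubsetsOfCard X r, (∀ x, t.row x = 1 → x ∈ R.1) ∧
      ∀ x, x ∈ R.1 → t.col x < j → t.row x = 1 := by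
  have hcard : ∀ i, (Finset.univ.filter fun x => t.row x = i ∧ t.col x < j).card ≤ j := by
    intro i
    conv_rhs => rw [← Finset.card_range j]
    refine Finset.card_le_card_of_injOn t.col ?_ ?_
    · intro x hx
      simpa using (Finset.mem_filter.1 hx).2.2
    · intro x hx y hy hxy
      exact t.ext_row_col ((Finset.mem_filter.1 hx).2.1.trans (Finset.mem_filter.1 hy).2.1.symm) hxy
  have h0 := hcard 0
  have h1 := hcard 1
  have hcompl := Finset.card_compl (Finset.univ.filter fun x => t.row x = 0 ∧ t.col x < j)
  obtain ⟨R, hR1, hR2, hR3⟩ := Finset.exists_subsuperset_card_eq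
    (s := Finset.univ.filter fun x => t.row x = 1 ∧ t.col x < j)
    (t := (Finset.univ.filter fun x => t.row x = 0 ∧ t.col x < j)ᶜ) (n := r)
    (by
      intro x hx
      simp only [Finset.mem_filter, Finset.mem_univ, true_and, Finset.mem_compl] at hx ⊢
      omega) (by omega) (by omega)
  refine ⟨⟨R, hR3⟩, fun x hx => hR1 ?_, fun x hx hc => ?_⟩
  · have := (mem_diagram_twoRow hj' _ _).1 (t.mem x)
    simp only [Finset.mem_filter, Finset.mem_univ, true_and]
    omega
  · have h2 := hR2 hx
    have := (mem_diagram_twoRow hj' _ _).1 (t.mem x)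
    simp only [Finset.mem_filter, Finset.mem_univ, true_and, Finset.mem_compl] at h2
    omega

/-- The permutation character on the subsets with `r` elements is the sum of the irreducible
characters labelled by the partitions with at most two parts, the second one being at most `r`. -/
theorem card_fixedBy_subsetsOfCard {n r : ℕ} (hX : Fintype.card X = n) (h : 2 * r ≤ n)
    (g : Equiv.Perm X) :
    (Nat.card (MulAction.fixedBy (SubsetsOfCard X r) g) : ℂ) =
      ∑ j : Fin (r + 1), chi (twoRow n j (by omega)) X g := by
  refine card_fixedBy_eq_sum_chi hX (fun j : Fin (r + 1) => twoRow n j (by omega)) ?_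
    (fun f R => ∀ x, f x = 1 → x ∈ R.1) ?_ ?_
    (fun a => ⟨(a.1.1 ∩ a.2.1).card, ?_⟩) ?_ g
  · intro i j hij
    exact Fin.ext (twoRow_injective _ _ hij)
  · intro g f R
    rw [← g.forall_congr_right]
    simp only [apply_mem_smul_subsetsOfCard]
    simp
  · intro j t
    obtain ⟨R, hR1, hR2⟩ := exists_subset_of_tableau_twoRow hX h (Nat.lt_succ_iff.1 j.2) _ t
    refine ⟨R, hR1, fun π hπ hπR => ?_⟩
    rw [mem_columnGroup] at hπ
    have h1 : ∀ y, t.row y = 1 → π y = y := by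
      intro y hy
      have hy' := (mem_diagram_twoRow (by omega) _ _).1 (t.mem y)
      have h2 := hR2 (π y) (hπR (π y) (by simpa using hy)) (by rw [hπ]; omega)
      exact t.ext_row_col (h2.trans hy.symm) (hπ y)
    have h2 : π = 1 := by
      refine Equiv.ext fun y => ?_
      have h3 := (mem_diagram_twoRow (by omega) _ _).1 (t.mem y)
      have h4 := (mem_diagram_twoRow (by omega) _ _).1 (t.mem (π y))
      by_cases h5 : t.row (π y) = 1
      · exact π.injective (h1 _ h5)
      · by_cases h6 : t.row y = 1
        · exact h1 y h6
        · exact t.ext_row_col (by rw [Equiv.Perm.one_apply]; omega) (hπ y)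
    rw [h2, map_one]
  · exact Nat.lt_succ_iff.2 ((Finset.card_le_card Finset.inter_subset_left).trans_eq a.1.2)
  · intro a b hab
    exact exists_smul_eq_of_card_inter_eq a b (congrArg Fin.val hab)

end Subsets

/-! ### The permutation character on perfect matchings -/

theorem mem_diagram_double {n : ℕ} (p : n.Partition) (i c : ℕ) :
    (i, c) ∈ diagram (double p) ↔ (i, c / 2) ∈ diagram p := by
  rw [mem_diagram, mem_diagram, double, Multiset.countP_map, Multiset.countP_eq_card_filter]
  have : ∀ a, c < 2 * a ↔ c / 2 < a := by omega
  simp only [this]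

theorem double_injective {n : ℕ} : Function.Injective (double : n.Partition → _) := by
  intro p q h
  ext1
  refine Multiset.map_injective (f := (2 * ·)) ?_ (congrArg Nat.Partition.parts h)
  intro a b hab
  simpa using hab

/-- The other column in the pair of columns `2k`, `2k + 1`. -/
def partner (c : ℕ) : ℕ := if c % 2 = 0 then c + 1 else c - 1

theorem partner_partner (c : ℕ) : partner (partner c) = c := by
  unfold partner; split_ifs <;> omega

theorem partner_ne (c : ℕ) : partner c ≠ c := by
  unfold partner; split_ifs <;> omega

theorem partner_div_two (c : ℕ) : partner c / 2 = c / 2 := by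
  unfold partner; split_ifs <;> omega

theorem partner_mod_two (c : ℕ) : partner c % 2 = 0 ↔ ¬ c % 2 = 0 := by
  unfold partner; split_ifs <;> omega

section Matchings

variable {X : Type} [Fintype X] [DecidableEq X]

/-- The perfect matchings of `X`, as involutions without fixed points. -/
abbrev Matching (X : Type) : Type := {s : Equiv.Perm X // (∀ x, s (s x) = x) ∧ ∀ x, s x ≠ x}

instance : MulAction (Equiv.Perm X) (Matching X) where
  smul g s := ⟨g * s.1 * g⁻¹, by simp [s.2.1], fun x hx => s.2.2 (g⁻¹ x) (by
    rw [Equiv.Perm.eq_inv_iff_eq]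
    simpa using hx)⟩
  one_smul s := Subtype.ext (by
    change 1 * s.1 * 1⁻¹ = s.1
    simp)
  mul_smul g h s := Subtype.ext (by
    change g * h * s.1 * (g * h)⁻¹ = g * (h * s.1 * h⁻¹) * g⁻¹
    group)

theorem coe_smul_matching (g : Equiv.Perm X) (s : Matching X) : (g • s).1 = g * s.1 * g⁻¹ := rfl

theorem smul_matching_apply (g : Equiv.Perm X) (s : Matching X) (x : X) :
    (g • s).1 (g x) = g (s.1 x) := by
  simp [coe_smul_matching]

theorem smul_matching_eq_iff (g : Equiv.Perm X) (s t : Matching X) :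
    g • s = t ↔ ∀ x, t.1 (g x) = g (s.1 x) := by
  constructor
  · rintro rfl x
    exact smul_matching_apply g s x
  · intro h
    refine Subtype.ext (Equiv.ext fun x => ?_)
    obtain ⟨y, rfl⟩ := g.surjective x
    rw [smul_matching_apply, h]

theorem sign_eq_one_of_commute_involution {ρ s : Equiv.Perm X} (hs : ∀ x, s (s x) = x)
    (hρs : ∀ x, ρ (s x) = s (ρ x)) (P : X → Prop) [DecidablePred P] (hP : ∀ x, P (s x) ↔ ¬ P x)
    (hρP : ∀ x, P (ρ x) ↔ P x) : Equiv.Perm.sign ρ = 1 := by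
  have hs' : ∀ x, s⁻¹ x = s x := fun x => by rw [Equiv.Perm.inv_eq_iff_eq, hs]
  let ρ₁ : Equiv.Perm X := Equiv.Perm.ofSubtype (ρ.subtypePerm hρP)
  have h1 : ∀ x, P x → ρ₁ x = ρ x := fun x hx => by
    rw [Equiv.Perm.ofSubtype_apply_of_mem _ hx]
    rfl
  have h2 : ∀ x, ¬ P x → ρ₁ x = x := fun x hx => Equiv.Perm.ofSubtype_apply_of_not_mem _ hx
  have h3 : ρ = ρ₁ * (s * ρ₁ * s⁻¹) := by
    refine Equiv.ext fun x => ?_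
    simp only [Equiv.Perm.mul_apply, hs']
    by_cases hx : P x
    · rw [h2 (s x) (by rw [hP]; exact not_not.2 hx), hs, h1 x hx]
    · rw [h1 (s x) ((hP x).2 hx), hρs, hs, h2 (ρ x) (by rwa [hρP])]
  rw [h3, map_mul, map_mul, map_mul, map_inv, mul_right_comm, mul_inv_cancel, one_mul,
    Int.units_mul_self]

theorem exists_matching_of_tableau_double {n : ℕ} (p : n.Partition)
    (t : Tableau (diagram (double p)) X) :
    ∃ s : Matching X, ∀ x, t.row (s.1 x) = t.row x ∧ t.col (s.1 x) = partner (t.col x) := by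
  have hex : ∀ x, ∃ y, t.row y = t.row x ∧ t.col y = partner (t.col x) := by
    intro x
    refine t.exists_cell ?_
    rw [mem_diagram_double, partner_div_two, ← mem_diagram_double]
    exact t.mem x
  choose σ hσ1 hσ2 using hex
  have hinv : Function.Involutive σ := fun x =>
    t.ext_row_col (by rw [hσ1, hσ1]) (by rw [hσ2, hσ2, partner_partner])
  exact ⟨⟨hinv.toPerm, hinv, fun x hx => partner_ne (t.col x) (by
    rw [← hσ2 x]; exact congrArg t.col hx)⟩, fun x => ⟨hσ1 x, hσ2 x⟩⟩

theorem sign_eq_one_of_rows_matched {n : ℕ} (p : n.Partition)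
    (t : Tableau (diagram (double p)) X) (s : Matching X)
    (hs : ∀ x, t.row (s.1 x) = t.row x ∧ t.col (s.1 x) = partner (t.col x))
    {π : Equiv.Perm X} (hπ : π ∈ columnGroup t)
    (h : ∀ x, t.row (π⁻¹ (s.1 x)) = t.row (π⁻¹ x)) : Equiv.Perm.sign π = 1 := by
  have hπ' := mem_columnGroup.1 (inv_mem_columnGroup hπ)
  rw [← Equiv.Perm.sign_inv]
  refine sign_eq_one_of_commute_involution s.2.1 (fun x => ?_) (fun x => t.col x % 2 = 0)
    (fun x => ?_) (fun x => ?_)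
  · refine t.ext_row_col ?_ ?_
    · rw [h, (hs _).1]
    · rw [hπ', (hs _).2, (hs _).2, hπ']
  · rw [(hs x).2, partner_mod_two]
  · rw [hπ']

/-! ### Pairs of perfect matchings up to conjugation -/

theorem orbitRel_mk_smul {D W : Type*} [Group D] [MulAction D W] (d : D) (w : W) :
    (Quotient.mk _ (d • w) : MulAction.orbitRel.Quotient D W) = Quotient.mk _ w :=
  Quotient.sound (MulAction.mem_orbit w d)

theorem exists_equivariant_equiv {D Y Z : Type*} [Group D] [MulAction D Y] [MulAction D Z]
    (e : MulAction.orbitRel.Quotient D Y ≃ MulAction.orbitRel.Quotient D Z)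
    (he : ∀ (y : Y) (z : Z), e (Quotient.mk _ y) = Quotient.mk _ z →
      MulAction.stabilizer D y = MulAction.stabilizer D z) :
    ∃ F : Y ≃ Z, ∀ (d : D) (y : Y), F (d • y) = d • F y := by
  have hrep : ∀ y : Y, ∃ d : D,
      d • (Quotient.mk _ y : MulAction.orbitRel.Quotient D Y).out = y := fun y => by
    obtain ⟨d, hd⟩ := Quotient.exact (Quotient.out_eq
      (Quotient.mk _ y : MulAction.orbitRel.Quotient D Y)).symm
    exact ⟨d, hd⟩
  choose d hd using hrep
  let F : Y → Z := fun y => d y • (e (Quotient.mk _ y)).out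
  have hstab : ∀ ω : MulAction.orbitRel.Quotient D Y,
      MulAction.stabilizer D ω.out = MulAction.stabilizer D (e ω).out := fun ω =>
    he _ _ (by rw [Quotient.out_eq, Quotient.out_eq])
  have hF : ∀ (ω : MulAction.orbitRel.Quotient D Y) (c : D), F (c • ω.out) = c • (e ω).out := by
    intro ω c
    have h1 : (Quotient.mk _ (c • ω.out) : MulAction.orbitRel.Quotient D Y) = ω := by
      rw [orbitRel_mk_smul, Quotient.out_eq]
    have h2 := hd (c • ω.out)
    change d (c • ω.out) • (e (Quotient.mk _ (c • ω.out))).out = _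
    rw [h1] at h2 ⊢
    have h3 : c⁻¹ * d (c • ω.out) ∈ MulAction.stabilizer D ω.out := by
      rw [MulAction.mem_stabilizer_iff, mul_smul, h2, inv_smul_smul]
    rw [hstab, MulAction.mem_stabilizer_iff, mul_smul, inv_smul_eq_iff] at h3
    exact h3
  have hbij : Function.Bijective F := by
    constructor
    · intro y y' hyy
      have h1 : (Quotient.mk _ y : MulAction.orbitRel.Quotient D Y) = Quotient.mk _ y' := by
        refine e.injective ?_
        have h2 := congrArg (fun z => (Quotient.mk _ z : MulAction.orbitRel.Quotient D Z)) hyy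
        simpa only [F, orbitRel_mk_smul, Quotient.out_eq] using h2
      have h3 : (d y)⁻¹ * d y' ∈
          MulAction.stabilizer D (e (Quotient.mk _ y' : MulAction.orbitRel.Quotient D Y)).out := by
        rw [MulAction.mem_stabilizer_iff, mul_smul, inv_smul_eq_iff]
        have h4 : d y • (e (Quotient.mk _ y)).out = d y' • (e (Quotient.mk _ y')).out := hyy
        rw [h1] at h4
        exact h4.symm
      rw [← hstab, MulAction.mem_stabilizer_iff, mul_smul, inv_smul_eq_iff, hd y', ← h1, hd y] at h3
      exact h3.symm
    · intro z
      obtain ⟨c, hc⟩ := Quotient.exact (Quotient.out_eq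
        (Quotient.mk _ z : MulAction.orbitRel.Quotient D Z)).symm
      refine ⟨c • (e.symm (Quotient.mk _ z)).out, ?_⟩
      rw [hF, e.apply_symm_apply]
      exact hc
  refine ⟨Equiv.ofBijective F hbij, fun c y => ?_⟩
  change F (c • y) = c • F y
  conv_lhs => rw [← hd y, ← mul_smul, hF, mul_smul]

/-- The homomorphism from the infinite dihedral group given by a pair of perfect matchings. -/
def dihedralHom (a : Matching X × Matching X) : DihedralGroup 0 →* Equiv.Perm X :=
  have key : ∀ i : ℤ, (a.1.1 * a.2.1) ^ i * a.1.1 = a.1.1 * (a.1.1 * a.2.1) ^ (-i) := by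
    have h1 : SemiconjBy a.1.1 (a.1.1 * a.2.1) (a.1.1 * a.2.1)⁻¹ := by
      rw [SemiconjBy, eq_inv_mul_iff_mul_eq]
      refine Equiv.ext fun x => ?_
      simp [a.1.2.1, a.2.2.1]
    intro i
    have h2 := (h1.zpow_right (-i)).eq
    rw [inv_zpow, zpow_neg, inv_inv] at h2
    rw [zpow_neg, h2]
  { toFun := fun d => match d with
      | DihedralGroup.r i => (a.1.1 * a.2.1) ^ (id i : ℤ)
      | DihedralGroup.sr i => a.1.1 * (a.1.1 * a.2.1) ^ (id i : ℤ)
    map_one' := zpow_zero _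
    map_mul' := by
      have hs : a.1.1 * a.1.1 = 1 := Equiv.ext a.1.2.1
      rintro (i | i) (j | j)
      · exact zpow_add _ (id i : ℤ) (id j : ℤ)
      · change a.1.1 * (a.1.1 * a.2.1) ^ ((id j : ℤ) - (id i : ℤ)) =
          (a.1.1 * a.2.1) ^ (id i : ℤ) * (a.1.1 * (a.1.1 * a.2.1) ^ (id j : ℤ))
        rw [← mul_assoc, key, mul_assoc, ← zpow_add, neg_add_eq_sub]
      · change a.1.1 * (a.1.1 * a.2.1) ^ ((id i : ℤ) + (id j : ℤ)) =
          a.1.1 * (a.1.1 * a.2.1) ^ (id i : ℤ) * (a.1.1 * a.2.1) ^ (id j : ℤ)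
        rw [mul_assoc, ← zpow_add]
      · change (a.1.1 * a.2.1) ^ ((id j : ℤ) - (id i : ℤ)) =
          a.1.1 * (a.1.1 * a.2.1) ^ (id i : ℤ) * (a.1.1 * (a.1.1 * a.2.1) ^ (id j : ℤ))
        rw [mul_assoc, ← mul_assoc _ a.1.1, key, mul_assoc, ← zpow_add, ← mul_assoc, hs, one_mul,
          neg_add_eq_sub] }

/-- The set `X` with the action of the infinite dihedral group given by a pair of matchings. -/
def DihedralSet (_ : Matching X × Matching X) : Type := X

instance (a : Matching X × Matching X) : Fintype (DihedralSet a) := inferInstanceAs (Fintype X)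

instance (a : Matching X × Matching X) : MulAction (DihedralGroup 0) (DihedralSet a) :=
  MulAction.compHom X (dihedralHom a)

/-- The identity map from `DihedralSet a` to `X`. -/
def DihedralSet.equiv (a : Matching X × Matching X) : DihedralSet a ≃ X := Equiv.refl X

variable (a : Matching X × Matching X)

theorem equiv_r_smul (i : ℤ) (x : DihedralSet a) :
    DihedralSet.equiv a ((DihedralGroup.r i : DihedralGroup 0) • x) =
      ((a.1.1 * a.2.1) ^ i) (DihedralSet.equiv a x) := rfl

theorem equiv_sr_smul (i : ℤ) (x : DihedralSet a) :
    DihedralSet.equiv a ((DihedralGroup.sr i : DihedralGroup 0) • x) =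
      a.1.1 (((a.1.1 * a.2.1) ^ i) (DihedralSet.equiv a x)) := rfl

theorem sr_smul_ne (i : ℤ) (x : DihedralSet a) :
    (DihedralGroup.sr i : DihedralGroup 0) • x ≠ x := by
  have hconj : ∀ c j : ℤ, (DihedralGroup.sr (id (c + 2 * j) : ℤ) : DihedralGroup 0) =
      (DihedralGroup.r j)⁻¹ * DihedralGroup.sr c * DihedralGroup.r j := by
    intro c j
    exact congrArg (DihedralGroup.sr (n := 0)) (show c + 2 * j = c - -j + j by ring)
  intro h
  have key : ∀ c j : ℤ, i = c + 2 * j → ∃ y : DihedralSet a,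
      (DihedralGroup.sr c : DihedralGroup 0) • y = y := by
    intro c j hij
    refine ⟨(DihedralGroup.r j : DihedralGroup 0) • x, ?_⟩
    have h1 := (congrArg (· • x) (hconj c j)).symm.trans (hij ▸ h)
    rwa [mul_smul, mul_smul, inv_smul_eq_iff] at h1
  rcases Int.even_or_odd' i with ⟨j, hj | hj⟩
  · obtain ⟨y, hy⟩ := key 0 j (by omega)
    have h1 := congrArg (DihedralSet.equiv a) hy
    rw [equiv_sr_smul, zpow_zero] at h1
    exact a.1.2.2 _ h1
  · obtain ⟨y, hy⟩ := key 1 j (by omega)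
    have h1 := congrArg (DihedralSet.equiv a) hy
    rw [equiv_sr_smul, zpow_one, Equiv.Perm.mul_apply, a.1.2.1] at h1
    exact a.2.2.2 _ h1

/-- The length of the cycle through `x` of the product of the two matchings. -/
def cycleLength (x : DihedralSet a) : ℕ :=
  Function.minimalPeriod ((a.1.1 * a.2.1) • ·) (DihedralSet.equiv a x)

theorem r_smul_eq_iff (i : ℤ) (x : DihedralSet a) :
    (DihedralGroup.r i : DihedralGroup 0) • x = x ↔ (cycleLength a x : ℤ) ∣ i := by
  rw [← (DihedralSet.equiv a).injective.eq_iff, equiv_r_smul, cycleLength,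
    ← MulAction.zpow_smul_eq_iff_minimalPeriod_dvd]
  rfl

theorem stabilizer_eq_of_cycleLength_eq {a b : Matching X × Matching X} (x : DihedralSet a)
    (y : DihedralSet b) (h : cycleLength a x = cycleLength b y) :
    MulAction.stabilizer (DihedralGroup 0) x = MulAction.stabilizer (DihedralGroup 0) y := by
  ext d
  rw [MulAction.mem_stabilizer_iff, MulAction.mem_stabilizer_iff]
  rcases d with i | i
  · exact (r_smul_eq_iff a i x).trans (h ▸ (r_smul_eq_iff b i y).symm)
  · exact iff_of_false (sr_smul_ne a i x) (sr_smul_ne b i y)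

theorem card_orbit_dihedral (x : DihedralSet a) :
    Nat.card (MulAction.orbit (DihedralGroup 0) x) = 2 * cycleLength a x := by
  set A : Set X :=
    MulAction.orbit (Subgroup.zpowers (a.1.1 * a.2.1)) (DihedralSet.equiv a x) with hA
  have hmem : ∀ y, y ∈ A ↔ ∃ i : ℤ, ((a.1.1 * a.2.1) ^ i) (DihedralSet.equiv a x) = y := by
    intro y
    constructor
    · rintro ⟨⟨_, i, rfl⟩, rfl⟩
      exact ⟨i, rfl⟩
    · rintro ⟨i, rfl⟩
      exact ⟨⟨_, i, rfl⟩, rfl⟩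
  have hcard : A.ncard = cycleLength a x := by
    rw [← Nat.card_coe_set_eq, Nat.card_congr (MulAction.orbitZPowersEquiv _ _), Nat.card_zmod]
    rfl
  have horb : DihedralSet.equiv a '' MulAction.orbit (DihedralGroup 0) x = A ∪ a.1.1 '' A := by
    ext y
    simp only [Set.mem_union, Set.mem_image, hmem]
    constructor
    · rintro ⟨_, ⟨i | i, rfl⟩, rfl⟩
      · exact Or.inl ⟨i, rfl⟩
      · exact Or.inr ⟨_, ⟨i, rfl⟩, rfl⟩
    · rintro (⟨i, rfl⟩ | ⟨_, ⟨i, rfl⟩, rfl⟩)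
      · exact ⟨_, ⟨DihedralGroup.r i, rfl⟩, rfl⟩
      · exact ⟨_, ⟨DihedralGroup.sr i, rfl⟩, rfl⟩
  have hdisj : Disjoint A (a.1.1 '' A) := by
    rw [Set.disjoint_left]
    rintro y hy ⟨z, hz, hzy⟩
    obtain ⟨i, hi⟩ := (hmem y).1 hy
    obtain ⟨j, hj⟩ := (hmem z).1 hz
    have h1 : (DihedralGroup.sr j : DihedralGroup 0) • x =
        (DihedralGroup.r i : DihedralGroup 0) • x := by
      refine (DihedralSet.equiv a).injective ?_
      rw [equiv_sr_smul, equiv_r_smul, hj, hi, hzy]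
    rw [← inv_smul_eq_iff, ← mul_smul] at h1
    exact sr_smul_ne a (j - -i) x h1
  rw [Nat.card_coe_set_eq, ← Set.ncard_image_of_injective _ (DihedralSet.equiv a).injective, horb,
    Set.ncard_union_eq hdisj (Set.toFinite _) (Set.toFinite _),
    Set.ncard_image_of_injective _ a.1.1.injective, hcard, two_mul]

/-- Half the number of elements of an orbit of the dihedral group. -/
def halfOrbit (ω : MulAction.orbitRel.Quotient (DihedralGroup 0) (DihedralSet a)) : ℕ :=
  cycleLength a ω.out

theorem card_orbit_eq (ω : MulAction.orbitRel.Quotient (DihedralGroup 0) (DihedralSet a)) :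
    Nat.card ω.orbit = 2 * halfOrbit a ω := by
  rw [halfOrbit, ← card_orbit_dihedral,
    MulAction.orbitRel.Quotient.orbit_eq_orbit_out ω Quotient.out_eq]

theorem halfOrbit_mk (x : DihedralSet a) : halfOrbit a (Quotient.mk _ x) = cycleLength a x := by
  have h1 := card_orbit_eq a (Quotient.mk _ x)
  rw [MulAction.orbitRel.Quotient.orbit_mk, card_orbit_dihedral] at h1
  omega

open Classical in
/-- The partition of half the number of elements of `X` given by the sizes of the components of
the union of two perfect matchings. -/
def matchingPairPartition {n : ℕ} (hX : Fintype.card X = 2 * n) : n.Partition where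
  parts := Finset.univ.val.map (halfOrbit a)
  parts_pos := by
    intro i hi
    obtain ⟨ω, _, rfl⟩ := Multiset.mem_map.1 hi
    have h1 := card_orbit_eq a ω
    have : Nonempty ω.orbit := by
      rw [MulAction.orbitRel.Quotient.orbit_eq_orbit_out ω Quotient.out_eq]
      exact ⟨⟨_, MulAction.mem_orbit_self _⟩⟩
    have : 0 < Nat.card ω.orbit := Nat.card_pos
    omega
  parts_sum := by
    have h1 := Nat.card_congr (MulAction.selfEquivSigmaOrbits' (DihedralGroup 0) (DihedralSet a))
    rw [Nat.card_sigma] at h1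
    simp only [card_orbit_eq] at h1
    rw [← Finset.mul_sum, Nat.card_congr (DihedralSet.equiv a), Nat.card_eq_fintype_card, hX] at h1
    exact (Nat.eq_of_mul_eq_mul_left two_pos h1).symm

theorem exists_smul_eq_of_matchingPairPartition_eq {n : ℕ} (hX : Fintype.card X = 2 * n)
    (a b : Matching X × Matching X)
    (h : matchingPairPartition a hX = matchingPairPartition b hX) :
    ∃ g : Equiv.Perm X, g • a = b := by
  classical
  have hparts := congrArg Nat.Partition.parts h
  obtain ⟨e, he⟩ := exists_equiv_comp_eq (halfOrbit a) (halfOrbit b) (fun i => by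
    have h1 := congrArg (Multiset.count i) hparts
    simp only [matchingPairPartition, Multiset.count_map] at h1
    simp only [eq_comm (b := i)]
    exact h1)
  obtain ⟨F, hF⟩ := exists_equivariant_equiv e (fun x y hxy => by
    refine stabilizer_eq_of_cycleLength_eq x y ?_
    rw [← halfOrbit_mk, ← halfOrbit_mk, ← hxy, he])
  refine ⟨(DihedralSet.equiv a).symm.trans (F.trans (DihedralSet.equiv b)), Prod.ext ?_ ?_⟩
  · change _ • a.1 = b.1
    rw [smul_matching_eq_iff]
    intro x
    exact (congrArg (DihedralSet.equiv b)
      (hF (DihedralGroup.sr (0 : ℤ)) ((DihedralSet.equiv a).symm x))).symm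
  · change _ • a.2 = b.2
    rw [smul_matching_eq_iff]
    intro x
    have h1 := (congrArg (DihedralSet.equiv b)
      (hF (DihedralGroup.sr (1 : ℤ)) ((DihedralSet.equiv a).symm x))).symm
    have h2 : ∀ (c : Matching X × Matching X) (z : DihedralSet c),
        (DihedralGroup.sr (1 : ℤ) : DihedralGroup 0) • z =
          (DihedralSet.equiv c).symm (c.2.1 (DihedralSet.equiv c z)) := by
      intro c z
      refine (DihedralSet.equiv c).injective ?_
      rw [equiv_sr_smul, zpow_one, Equiv.Perm.mul_apply, c.1.2.1, Equiv.apply_symm_apply]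
    rw [h2, h2] at h1
    simpa using h1

/-- The permutation character on the perfect matchings is the sum of the irreducible characters
labelled by the partitions with even parts. -/
theorem card_fixedBy_matching {n : ℕ} (hX : Fintype.card X = 2 * n) (g : Equiv.Perm X) :
    (Nat.card (MulAction.fixedBy (Matching X) g) : ℂ) =
      ∑ p : n.Partition, chi (double p) X g := by
  refine card_fixedBy_eq_sum_chi hX double double_injective (fun f s => ∀ x, f (s.1 x) = f x) ?_ ?_
    (fun a => matchingPairPartition a hX) ?_ g
  · intro g f s
    rw [← g.forall_congr_right]
    simp only [smul_matching_apply]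
    simp
  · intro p t
    obtain ⟨s, hs⟩ := exists_matching_of_tableau_double p t
    exact ⟨s, fun x => (hs x).1, fun π hπ h => sign_eq_one_of_rows_matched p t s hs hπ h⟩
  · exact exists_smul_eq_of_matchingPairPartition_eq hX

end Matchings

/-! ### Frobenius reciprocity -/

section Frobenius

variable {G H : Type} [Group G] [Fintype G] [Group H] [Fintype H] (φ : H →* G)
  {A B : Type} [AddCommGroup A] [Module ℂ A] [FiniteDimensional ℂ A]
  [AddCommGroup B] [Module ℂ B] [FiniteDimensional ℂ B]

instance finiteDimensional_indV (ρ : Representation ℂ H A) :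
    FiniteDimensional ℂ (Representation.IndV φ ρ) :=
  Module.Finite.of_surjective (Representation.Coinvariants.mk _)
    (Representation.Coinvariants.mk_surjective _)

theorem finrank_intertwiningMap_ind (ρ : Representation ℂ H A) (σ : Representation ℂ G B) :
    Module.finrank ℂ (Representation.IntertwiningMap (Representation.ind φ ρ) σ) =
      Module.finrank ℂ (Representation.IntertwiningMap ρ (σ.comp φ)) :=
  LinearEquiv.finrank_eq ((Rep.homLinearEquiv (Rep.ind φ (Rep.of ρ)) (Rep.of σ)).symm ≪≫ₗ
    Rep.indResHomEquiv φ (Rep.of ρ) (Rep.of σ) ≪≫ₗ Rep.homLinearEquiv _ _)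

theorem cfInner_character_ind (ρ : Representation ℂ H A) (σ : Representation ℂ G B) :
    cfInner (Representation.ind φ ρ).character σ.character =
      cfInner ρ.character (σ.character ∘ φ) := by
  rw [cfInner_comm, cfInner_character, finrank_intertwiningMap_ind, ← cfInner_character,
    cfInner_comm]
  rfl

end Frobenius

/-! ### Characters and relabelling -/

section Relabel

variable {X Y : Type} [Fintype X] [DecidableEq X] [Fintype Y] [DecidableEq Y] (e : X ≃ Y)

theorem permCongr_inv_apply (g : Equiv.Perm X) (y : Y) :
    (e.permCongr g)⁻¹ y = e (g⁻¹ (e.symm y)) := rfl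

/-- Relabelling as an isomorphism of permutation modules. -/
def relabel : ((X → ℕ) →₀ ℂ) ≃ₗ[ℂ] ((Y → ℕ) →₀ ℂ) :=
  Finsupp.domLCongr (e.arrowCongr (Equiv.refl ℕ))

theorem relabel_single (f : X → ℕ) (c : ℂ) :
    relabel e (Finsupp.single f c) = Finsupp.single (f ∘ e.symm) c := by
  simp [relabel, Equiv.arrowCongr]

theorem relabel_tabloidRep (g : Equiv.Perm X) (v : (X → ℕ) →₀ ℂ) :
    relabel e (tabloidRep X g v) = tabloidRep Y (e.permCongr g) (relabel e v) := by
  induction v using Finsupp.induction_linear with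
  | zero => simp
  | add v w hv hw => simp only [map_add, hv, hw]
  | single f c =>
    rw [tabloidRep_single, relabel_single, relabel_single, tabloidRep_single]
    congr 1
    funext y
    simp only [Function.comp_apply, permCongr_inv_apply, e.symm_apply_apply]

theorem relabel_polytabloid {μ : YoungDiagram} (t : Tableau μ X) :
    relabel e (polytabloid t) = polytabloid (t.trans e : Tableau μ Y) := by
  simp only [polytabloid, map_sum, relabel_single]
  refine Finset.sum_equiv e.permCongr ?_ ?_
  · intro π
    simp only [Finset.mem_filter, Finset.mem_univ, true_and]
    rw [← e.forall_congr_right]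
    simp [Tableau.col, Equiv.permCongr_apply]
  · intro π _
    rw [Equiv.Perm.sign_permCongr]
    congr 1
    funext y
    simp only [Function.comp_apply, permCongr_inv_apply, Tableau.row, Equiv.symm_trans_apply,
      e.symm_apply_apply]

/-- Relabelling as an isomorphism of Specht modules. -/
def spechtRelabel {n : ℕ} (p : n.Partition) : SpechtModule p X ≃ₗ[ℂ] SpechtModule p Y :=
  LinearEquiv.ofSubmodules (relabel e) (spechtSub (diagram p) X).toSubmodule
    (spechtSub (diagram p) Y).toSubmodule (by
      change Submodule.map (relabel e).toLinearMap (Submodule.span ℂ _) = Submodule.span ℂ _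
      rw [Submodule.map_span, ← Set.range_comp]
      congr 1
      ext v
      constructor
      · rintro ⟨t, rfl⟩
        exact ⟨_, (relabel_polytabloid e t).symm⟩
      · rintro ⟨t, rfl⟩
        refine ⟨t.trans e.symm, (relabel_polytabloid e _).trans ?_⟩
        congr 1
        ext
        simp)

theorem chi_permCongr {n : ℕ} (p : n.Partition) (g : Equiv.Perm X) :
    chi p Y (e.permCongr g) = chi p X g := by
  have h : specht p Y (e.permCongr g) = (spechtRelabel e p).conj (specht p X g) := by
    refine LinearMap.ext fun v => ?_
    obtain ⟨v, rfl⟩ := (spechtRelabel e p).surjective v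
    rw [LinearEquiv.conj_apply_apply, LinearEquiv.symm_apply_apply]
    exact spechtIncl_injective p (relabel_tabloidRep e g (spechtIncl p X v)).symm
  rw [chi, Representation.character, h, LinearMap.trace_conj']
  rfl

end Relabel

/-! ### Incidence relations between transitive group actions -/

section Transfer

variable {G : Type*} [Group G] [Fintype G] {A B : Type*} [Fintype A] [Fintype B] [MulAction G A]
  [MulAction G B]

open Classical in
theorem cfInner_fibred {H : Type*} [Group H] [Fintype H] (φ : H →* G)
    (hφ : Function.Injective φ) (a : A) (hrange : ∀ g : G, g • a = a ↔ g ∈ φ.range)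
    (htrans : ∀ b : A, ∃ g : G, g • a = b) (Ψ : G → A → ℂ)
    (hΨ : ∀ (k g : G) (b : A), Ψ (k * g * k⁻¹) (k • b) = Ψ g b) (f : G → ℂ)
    (hf : ∀ g k, f (k * g * k⁻¹) = f g) :
    cfInner (fun g => ∑ b : A with g • b = b, Ψ g b) f =
      cfInner (fun h => Ψ (φ h) a) (f ∘ φ) := by
  have hfib : ∀ b : A, ∑ g : G with g • b = b, Ψ g b * f g⁻¹ =
      ∑ h : H, Ψ (φ h) a * f (φ h)⁻¹ := by
    intro b
    obtain ⟨k, rfl⟩ := htrans b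
    refine (Finset.sum_bij (fun h _ => k * φ h * k⁻¹) ?_ ?_ ?_ ?_).symm
    · intro h _
      have := (hrange (φ h)).2 ⟨h, rfl⟩
      simp [mul_smul, this]
    · intro h _ h' _ hh
      exact hφ (by simpa using hh)
    · intro g hg
      have hg' : (k⁻¹ * g * k) • a = a := by
        rw [mul_smul, mul_smul, (Finset.mem_filter.1 hg).2, inv_smul_smul]
      obtain ⟨h, hh⟩ := (hrange _).1 hg'
      exact ⟨h, Finset.mem_univ _, by rw [hh]; group⟩
    · intro h _
      rw [hΨ, ← hf (φ h)⁻¹ k]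
      congr 2
      group
  have hcard : Nat.card G = Nat.card A * Nat.card H := by
    have h1 := MulAction.card_orbit_mul_card_stabilizer_eq_card_group G a
    have h2 : Fintype.card (MulAction.orbit G a) = Nat.card A := by
      rw [← Nat.card_eq_fintype_card]
      exact Nat.card_congr ((Equiv.setCongr (Set.eq_univ_of_forall htrans)).trans
        (Equiv.Set.univ A))
    have h3 : Fintype.card (MulAction.stabilizer G a) = Nat.card H := by
      rw [← Nat.card_eq_fintype_card]
      have : MulAction.stabilizer G a = φ.range := Subgroup.ext hrange
      rw [this]
      exact (Nat.card_congr (MonoidHom.ofInjective hφ).toEquiv).symm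
    rw [Nat.card_eq_fintype_card (α := G), ← h1, h2, h3]
  have hA : (Nat.card A : ℂ) ≠ 0 := Nat.cast_ne_zero.2 (by
    have : Nonempty A := ⟨a⟩
    exact Nat.card_pos.ne')
  unfold cfInner
  simp only [Finset.sum_mul, Function.comp_apply, map_inv]
  rw [Finset.sum_comm' (t' := Finset.univ) (s' := fun b => Finset.univ.filter fun g => g • b = b)
    (by simp), Finset.sum_congr rfl fun b _ => hfib b]
  rw [Finset.sum_const, Finset.card_univ, ← Nat.card_eq_fintype_card, nsmul_eq_mul, hcard,
    Nat.cast_mul, mul_inv, ← mul_assoc, mul_right_comm _ _ (Nat.card A : ℂ), inv_mul_cancel₀ hA,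
    one_mul]

/-- Both sides are the inner product of `f` with the permutation character on the incident
pairs. -/
theorem cfInner_incidence {H K : Type*} [Group H] [Fintype H] [Group K] [Fintype K]
    (φ : H →* G) (hφ : Function.Injective φ) (a : A) (ha : ∀ g : G, g • a = a ↔ g ∈ φ.range)
    (hA : ∀ a' : A, ∃ g : G, g • a = a')
    (ψ : K →* G) (hψ : Function.Injective ψ) (b : B) (hb : ∀ g : G, g • b = b ↔ g ∈ ψ.range)
    (hB : ∀ b' : B, ∃ g : G, g • b = b')
    (I : A → B → Prop) (hI : ∀ (g : G) a b, I (g • a) (g • b) ↔ I a b)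
    (f : G → ℂ) (hf : ∀ g k, f (k * g * k⁻¹) = f g) :
    cfInner (fun h => (Nat.card {b : B // φ h • b = b ∧ I a b} : ℂ)) (f ∘ φ) =
      cfInner (fun k => (Nat.card {a : A // ψ k • a = a ∧ I a b} : ℂ)) (f ∘ ψ) := by
  classical
  rw [← cfInner_fibred φ hφ a ha hA
      (fun g a => (Nat.card {b : B // g • b = b ∧ I a b} : ℂ)) ?_ f hf,
    ← cfInner_fibred ψ hψ b hb hB
      (fun g b => (Nat.card {a : A // g • a = a ∧ I a b} : ℂ)) ?_ f hf]
  · congr 1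
    funext g
    rw [← Nat.cast_sum, ← Nat.cast_sum]
    congr 1
    have h := Finset.sum_card_bipartiteAbove_eq_sum_card_bipartiteBelow I
      (s := Finset.univ.filter fun a : A => g • a = a)
      (t := Finset.univ.filter fun b : B => g • b = b)
    simp only [Finset.bipartiteAbove, Finset.bipartiteBelow, Finset.filter_filter] at h
    simpa only [Nat.card_eq_fintype_card, Fintype.card_subtype] using h
  · intro k g b
    congr 1
    refine (Nat.card_congr ((MulAction.toPerm k).subtypeEquiv fun a => ?_)).symm
    change _ ↔ (k * g * k⁻¹) • k • a = k • a ∧ I (k • a) (k • b)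
    rw [hI, mul_smul, mul_smul, inv_smul_smul, smul_left_cancel_iff]
  · intro k g a
    congr 1
    refine (Nat.card_congr ((MulAction.toPerm k).subtypeEquiv fun b => ?_)).symm
    change _ ↔ (k * g * k⁻¹) • k • b = k • b ∧ I (k • a) (k • b)
    rw [hI, mul_smul, mul_smul, inv_smul_smul, smul_left_cancel_iff]

end Transfer

/-! ### Matchings and invariant subsets -/

section Incidence

variable {X : Type} [Fintype X] [DecidableEq X]

theorem exists_smul_matching_eq (s t : Matching X) : ∃ g : Equiv.Perm X, g • s = t := by
  have hrep : ∀ u : Matching X, u.1.cycleType = Multiset.replicate (Fintype.card X / 2) 2 := by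
    intro u
    have h1 : ∀ c ∈ u.1.cycleType, c = 2 := by
      rw [← Equiv.Perm.pow_prime_eq_one_iff]
      exact Equiv.ext fun x => by rw [pow_two]; exact u.2.1 x
    have h2 := Multiset.eq_replicate_card.2 h1
    have h3 := u.1.sum_cycleType
    have h4 : u.1.support = Finset.univ := by
      ext x
      simp [u.2.2 x]
    rw [h4, Finset.card_univ, h2, Multiset.sum_replicate, smul_eq_mul] at h3
    rw [h2, ← h3, Nat.mul_div_cancel _ two_pos]
  obtain ⟨g, hg⟩ := isConj_iff.1 (Equiv.Perm.isConj_iff_cycleType_eq.2 ((hrep s).trans (hrep t).symm))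
  exact ⟨g, Subtype.ext hg⟩

theorem exists_smul_subset_eq {r : ℕ} (R S : SubsetsOfCard X r) :
    ∃ g : Equiv.Perm X, g • R = S := by
  obtain ⟨g, hg⟩ := exists_smul_eq_of_card_inter_eq (R, R) (S, S) (by
    rw [Finset.inter_self, Finset.inter_self, R.2, S.2])
  exact ⟨g, congrArg Prod.fst hg⟩

theorem smul_subset_eq_iff {r : ℕ} (g : Equiv.Perm X) (R : SubsetsOfCard X r) :
    g • R = R ↔ ∀ x, g x ∈ R.1 ↔ x ∈ R.1 := by
  constructor
  · intro h x
    conv_lhs => rw [← h]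
    exact apply_mem_smul_subsetsOfCard g R x
  · intro h
    refine Subtype.ext (Finset.ext fun x => ?_)
    obtain ⟨y, rfl⟩ := g.surjective x
    rw [apply_mem_smul_subsetsOfCard, h]

/-- A subset is a union of edges of a matching. -/
def IsUnionOfEdges {r : ℕ} (s : Matching X) (R : SubsetsOfCard X r) : Prop :=
  ∀ x, s.1 x ∈ R.1 ↔ x ∈ R.1

theorem isUnionOfEdges_smul {r : ℕ} (g : Equiv.Perm X) (s : Matching X) (R : SubsetsOfCard X r) :
    IsUnionOfEdges (g • s) (g • R) ↔ IsUnionOfEdges s R := by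
  unfold IsUnionOfEdges
  rw [← g.forall_congr_right]
  simp only [smul_matching_apply, apply_mem_smul_subsetsOfCard]

end Incidence

section Young

variable {α β X : Type} [Fintype α] [DecidableEq α] [Fintype β] [DecidableEq β] [Fintype X]
  [DecidableEq X] (e : α ⊕ β ≃ X)

/-- The embedding of a Young subgroup with two factors. -/
def youngEmb : Equiv.Perm α × Equiv.Perm β →* Equiv.Perm X :=
  e.permCongrHom.toMonoidHom.comp (Equiv.Perm.sumCongrHom α β)

theorem youngEmb_apply (w : Equiv.Perm α × Equiv.Perm β) (z : α ⊕ β) :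
    youngEmb e w (e z) = e (Equiv.Perm.sumCongr w.1 w.2 z) := by
  change e (Equiv.Perm.sumCongr w.1 w.2 (e.symm (e z))) = _
  rw [e.symm_apply_apply]

theorem youngEmb_injective : Function.Injective (youngEmb e) :=
  e.permCongrHom.injective.comp Equiv.Perm.sumCongrHom_injective

/-- The second block of a Young subgroup with two factors. -/
def youngBlock {m : ℕ} (hm : Fintype.card β = m) : SubsetsOfCard X m :=
  ⟨Finset.univ.map (Function.Embedding.inr.trans e.toEmbedding), by
    rw [Finset.card_map, Finset.card_univ, hm]⟩

variable {m : ℕ} (hm : Fintype.card β = m)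

theorem mem_youngBlock (z : α ⊕ β) : e z ∈ (youngBlock e hm).1 ↔ ∃ b, z = Sum.inr b := by
  simp [youngBlock, eq_comm]

theorem preserves_youngBlock_iff (g : Equiv.Perm X) :
    (∀ x, g x ∈ (youngBlock e hm).1 ↔ x ∈ (youngBlock e hm).1) ↔ g ∈ (youngEmb e).range := by
  constructor
  · intro h
    have h1 : e.permCongr.symm g ∈ (Equiv.Perm.sumCongrHom α β).range := by
      refine Equiv.Perm.mem_sumCongrHom_range_of_perm_mapsTo_inl ?_
      rintro _ ⟨a, rfl⟩
      have h2 := h (e (Sum.inl a))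
      rw [mem_youngBlock] at h2
      change e.symm (g (e (Sum.inl a))) ∈ _
      rcases h3 : e.symm (g (e (Sum.inl a))) with b | b
      · exact ⟨b, rfl⟩
      · rw [Equiv.symm_apply_eq] at h3
        rw [h3, mem_youngBlock] at h2
        obtain ⟨c, hc⟩ := h2.1 ⟨b, rfl⟩
        cases hc
    obtain ⟨w, hw⟩ := h1
    refine ⟨w, ?_⟩
    change e.permCongr (Equiv.Perm.sumCongrHom α β w) = g
    rw [hw, Equiv.apply_symm_apply]
  · rintro ⟨w, rfl⟩ x
    obtain ⟨z, rfl⟩ := e.surjective x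
    rw [youngEmb_apply, mem_youngBlock, mem_youngBlock]
    rcases z with a | b <;> simp

theorem smul_youngBlock_eq_iff (g : Equiv.Perm X) :
    g • youngBlock e hm = youngBlock e hm ↔ g ∈ (youngEmb e).range := by
  rw [smul_subset_eq_iff, preserves_youngBlock_iff]

/-- The union of two matchings. -/
def matchingSum (s : Matching α) (t : Matching β) : Matching X :=
  ⟨youngEmb e (s.1, t.1), by
    constructor
    · intro x
      obtain ⟨z, rfl⟩ := e.surjective x
      rw [youngEmb_apply, youngEmb_apply]
      rcases z with a | b
      · simp [s.2.1]
      · simp [t.2.1]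
    · intro x
      obtain ⟨z, rfl⟩ := e.surjective x
      rw [youngEmb_apply, e.injective.ne_iff]
      rcases z with a | b
      · simpa using s.2.2 a
      · simpa using t.2.2 b⟩

theorem youngEmb_smul_matchingSum (w : Equiv.Perm α × Equiv.Perm β) (s : Matching α)
    (t : Matching β) :
    youngEmb e w • matchingSum e s t = matchingSum e (w.1 • s) (w.2 • t) := by
  refine Subtype.ext ?_
  change youngEmb e w * youngEmb e (s.1, t.1) * (youngEmb e w)⁻¹ = youngEmb e _
  rw [← map_mul, ← map_inv, ← map_mul]
  rfl

theorem matchingSum_injective :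
    Function.Injective fun q : Matching α × Matching β => matchingSum e q.1 q.2 := by
  intro q q' h
  have h1 := youngEmb_injective e (congrArg Subtype.val h)
  exact Prod.ext (Subtype.ext (congrArg Prod.fst h1)) (Subtype.ext (congrArg Prod.snd h1))

theorem isUnionOfEdges_youngBlock_iff (s : Matching X) :
    IsUnionOfEdges s (youngBlock e hm) ↔ ∃ q : Matching α × Matching β, matchingSum e q.1 q.2 = s := by
  unfold IsUnionOfEdges
  rw [preserves_youngBlock_iff]
  constructor
  · rintro ⟨w, hw⟩
    have h1 := s.2.1
    have h2 := s.2.2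
    simp only [← hw] at h1 h2
    refine ⟨(⟨w.1, fun a => ?_, fun a ha => ?_⟩, ⟨w.2, fun b => ?_, fun b hb => ?_⟩),
      Subtype.ext hw⟩
    · simpa [youngEmb_apply] using h1 (e (Sum.inl a))
    · exact h2 (e (Sum.inl a)) (by simp [youngEmb_apply, ha])
    · simpa [youngEmb_apply] using h1 (e (Sum.inr b))
    · exact h2 (e (Sum.inr b)) (by simp [youngEmb_apply, hb])
  · rintro ⟨q, rfl⟩
    exact ⟨(q.1.1, q.2.1), rfl⟩

theorem card_fixed_matchings_youngBlock (w : Equiv.Perm α × Equiv.Perm β) :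
    Nat.card {s : Matching X // youngEmb e w • s = s ∧ IsUnionOfEdges s (youngBlock e hm)} =
      Nat.card (MulAction.fixedBy (Matching α) w.1) *
        Nat.card (MulAction.fixedBy (Matching β) w.2) := by
  rw [← Nat.card_prod]
  refine (Nat.card_eq_of_bijective (fun q => ⟨matchingSum e q.1.1 q.2.1,
    by rw [youngEmb_smul_matchingSum, q.1.2, q.2.2],
    (isUnionOfEdges_youngBlock_iff e hm _).2 ⟨(q.1.1, q.2.1), rfl⟩⟩) ⟨?_, ?_⟩).symm
  · intro q q' h
    have h1 := matchingSum_injective e (a₁ := (q.1.1, q.2.1)) (a₂ := (q'.1.1, q'.2.1))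
      (congrArg Subtype.val h)
    exact Prod.ext (Subtype.ext (congrArg Prod.fst h1)) (Subtype.ext (congrArg Prod.snd h1))
  · rintro ⟨s, hs1, hs2⟩
    obtain ⟨q, rfl⟩ := (isUnionOfEdges_youngBlock_iff e hm s).1 hs2
    rw [youngEmb_smul_matchingSum] at hs1
    have h1 := matchingSum_injective e (a₁ := (w.1 • q.1, w.2 • q.2)) (a₂ := q) hs1
    exact ⟨(⟨q.1, congrArg Prod.fst h1⟩, ⟨q.2, congrArg Prod.snd h1⟩), rfl⟩

end Young

section Wreath

variable {n : ℕ}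

instance (m n : ℕ) : Fintype (Wreath m n) :=
  Fintype.ofEquiv _ SemidirectProduct.equivProd.symm

theorem wreathEmb_apply {m : ℕ} (w : Wreath m n) (i : Fin n) (x : Fin m) :
    wreathEmb m n w (i, x) = (w.right i, w.left (w.right i) x) := rfl

theorem wreathEmb_injective {m : ℕ} [NeZero m] : Function.Injective (wreathEmb m n) := by
  intro v w h
  have h1 : ∀ i x, (v.right i, v.left (v.right i) x) = (w.right i, w.left (w.right i) x) :=
    fun i x => congrArg (fun g : Equiv.Perm (Fin n × Fin m) => g (i, x)) h
  have hr : v.right = w.right := Equiv.ext fun i => congrArg Prod.fst (h1 i 0)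
  refine SemidirectProduct.ext (funext fun i => Equiv.ext fun x => ?_) hr
  obtain ⟨j, rfl⟩ := v.right.surjective i
  have := congrArg Prod.snd (h1 j x)
  rwa [← hr] at this

/-- The matching of `Fin n × Fin 2` whose edges are the blocks of the wreath product. -/
def blockMatching (n : ℕ) : Matching (Fin n × Fin 2) :=
  ⟨(Equiv.refl (Fin n)).prodCongr (Equiv.swap 0 1), by simp, by
    rintro ⟨i, x⟩ h
    have h1 := congrArg Prod.snd h
    fin_cases x <;> simp at h1⟩

theorem blockMatching_apply (i : Fin n) (x : Fin 2) :
    (blockMatching n).1 (i, x) = (i, Equiv.swap 0 1 x) := rfl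

theorem smul_blockMatching_eq_iff (g : Equiv.Perm (Fin n × Fin 2)) :
    g • blockMatching n = blockMatching n ↔ g ∈ (wreathEmb 2 n).range := by
  have hsnd : ∀ y : Fin 2, Equiv.swap 0 1 y ≠ y := by decide
  have hswap : ∀ x y : Fin 2, x ≠ y → x = Equiv.swap 0 1 y := by decide
  rw [smul_matching_eq_iff]
  constructor
  · intro h
    have hfst : ∀ i x, (g (i, x)).1 = (g (i, 0)).1 := by
      intro i x
      by_cases hx : x = 0
      · rw [hx]
      · rw [hswap x 0 hx, ← blockMatching_apply, ← h]
        rfl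
    have hsurj : Function.Surjective fun i => (g (i, 0)).1 := by
      intro j
      obtain ⟨⟨i, x⟩, hi⟩ := g.surjective (j, 0)
      exact ⟨i, by simp only [← hfst i x, hi]⟩
    let σ : Equiv.Perm (Fin n) := Equiv.ofBijective _ (Finite.surjective_iff_bijective.1 hsurj)
    have hσ : ∀ i x, (g (i, x)).1 = σ i := hfst
    have hinj : ∀ i, Function.Injective fun x => (g (i, x)).2 := by
      intro i x y hxy
      have h1 : g (i, x) = g (i, y) := Prod.ext ((hfst i x).trans (hfst i y).symm) hxy
      exact congrArg Prod.snd (g.injective h1)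
    refine ⟨⟨fun j => Equiv.ofBijective _ (Finite.injective_iff_bijective.1 (hinj (σ.symm j))), σ⟩,
      Equiv.ext ?_⟩
    rintro ⟨i, x⟩
    rw [wreathEmb_apply]
    refine Prod.ext (hσ i x).symm ?_
    change (g (σ.symm (σ i), x)).2 = _
    rw [σ.symm_apply_apply]
  · rintro ⟨w, rfl⟩ ⟨i, x⟩
    rw [blockMatching_apply, wreathEmb_apply, wreathEmb_apply, blockMatching_apply]
    refine Prod.ext rfl (hswap _ _ ?_).symm
    intro h
    exact hsnd x ((w.left (w.right i)).injective h)

theorem card_fixed_subsets_blockMatching (r : ℕ) (w : Wreath 2 n) :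
    Nat.card {R : SubsetsOfCard (Fin n × Fin 2) (2 * r) //
        wreathEmb 2 n w • R = R ∧ IsUnionOfEdges (blockMatching n) R} =
      Nat.card (MulAction.fixedBy (SubsetsOfCard (Fin n) r) w.right) := by
  have hswap : ∀ x y : Fin 2, x = y ∨ Equiv.swap 0 1 y = x := by decide
  refine (Nat.card_eq_of_bijective
    (fun S => ⟨⟨S.1.1 ×ˢ Finset.univ, by
        rw [Finset.card_product, S.1.2, Finset.card_univ, Fintype.card_fin, mul_comm]⟩, by
        rw [smul_subset_eq_iff]
        rintro ⟨i, x⟩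
        simpa [wreathEmb_apply] using (smul_subset_eq_iff _ _).1 S.2 i, by
        rintro ⟨i, x⟩
        simp [blockMatching_apply]⟩) ⟨?_, ?_⟩).symm
  · intro S T h
    refine Subtype.ext (Subtype.ext (Finset.ext fun i => ?_))
    have h1 := Finset.ext_iff.1 (congrArg (fun R => R.1.1) h) (i, 0)
    simpa using h1
  · rintro ⟨⟨R, hR⟩, h1, h2⟩
    rw [smul_subset_eq_iff] at h1
    have hmem : ∀ i x, (i, x) ∈ R ↔ (i, 0) ∈ R := by
      intro i x
      rcases hswap x 0 with hx | hx
      · rw [hx]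
      · rw [← hx]
        exact h2 (i, 0)
    let S : Finset (Fin n) := Finset.univ.filter fun i => (i, 0) ∈ R
    have hS : S ×ˢ Finset.univ = R := by
      ext ⟨i, x⟩
      simp [S, hmem i x]
    have hcard : S.card = r := by
      have h3 := congrArg Finset.card hS
      rw [Finset.card_product, hR, Finset.card_univ, Fintype.card_fin] at h3
      omega
    refine ⟨⟨⟨S, hcard⟩, (smul_subset_eq_iff _ _).2 fun i => ?_⟩, Subtype.ext (Subtype.ext hS)⟩
    have h3 := h1 (i, 0)
    rw [wreathEmb_apply, hmem] at h3
    simpa [S] using h3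

end Wreath

/-! ### Littlewood–Richardson coefficients and the conclusion -/

theorem lrCoeff_eq_cfInner {k a b : ℕ} (l : k.Partition) (σ : a.Partition) (τ : b.Partition) :
    (lrCoeff l σ τ : ℂ) = cfInner
      (fun w : Equiv.Perm (Fin a) × Equiv.Perm (Fin b) => chi σ (Fin a) w.1 * chi τ (Fin b) w.2)
      (chi l (Fin a ⊕ Fin b) ∘ Equiv.Perm.sumCongrHom (Fin a) (Fin b)) := by
  unfold lrCoeff
  rw [← cfInner_character, cfInner_character_ind, outerSpecht, Representation.char_tensor]
  rfl

theorem sum_lrCoeff_double {n k r : ℕ} (h : k + r = n) (l : (2 * n).Partition) :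
    (∑ α : k.Partition, ∑ β : r.Partition, (lrCoeff l (double α) (double β) : ℂ)) =
      cfInner (fun w : Wreath 2 n =>
          (Nat.card (MulAction.fixedBy (SubsetsOfCard (Fin n) r) w.right) : ℂ))
        (chi l (Fin n × Fin 2) ∘ wreathEmb 2 n) := by
  have e : Fin (2 * k) ⊕ Fin (2 * r) ≃ Fin n × Fin 2 := Fintype.equivOfCardEq (by simp; omega)
  have hchi : chi l (Fin (2 * k) ⊕ Fin (2 * r)) ∘ Equiv.Perm.sumCongrHom _ _ =
      chi l (Fin n × Fin 2) ∘ youngEmb e :=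
    funext fun w => (chi_permCongr e l (Equiv.Perm.sumCongrHom _ _ w)).symm
  have h1 := cfInner_incidence (wreathEmb 2 n) wreathEmb_injective (blockMatching n)
    smul_blockMatching_eq_iff (exists_smul_matching_eq _) (youngEmb e) (youngEmb_injective e)
    (youngBlock e (Fintype.card_fin _)) (smul_youngBlock_eq_iff e (Fintype.card_fin _))
    (exists_smul_subset_eq _) IsUnionOfEdges isUnionOfEdges_smul (chi l (Fin n × Fin 2)) (fun g k => Representation.char_conj _ g k)
  simp only [card_fixed_subsets_blockMatching, card_fixed_matchings_youngBlock] at h1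
  rw [h1]
  simp only [lrCoeff_eq_cfInner, hchi]
  simp only [← cfInner_sum_left]
  congr 1
  funext w
  rw [Nat.cast_mul, card_fixedBy_matching (n := k) (by simp),
    card_fixedBy_matching (n := r) (by simp), Finset.sum_mul_sum]
  simp only [Finset.sum_apply]

theorem cfInner_foulkes {m n k : ℕ} (ν : n.Partition) (l : k.Partition) :
    cfInner (foulkes m ν) (chi l (Fin n × Fin m)) =
      cfInner (fun w : Wreath m n => chi ν (Fin n) w.right)
        (chi l (Fin n × Fin m) ∘ wreathEmb m n) := by
  unfold foulkes
  rw [chi, cfInner_character_ind]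
  rfl

theorem chi_twoRow_zero {n : ℕ} (h : 2 * 0 ≤ n) (g : Equiv.Perm (Fin n)) :
    chi (twoRow n 0 h) (Fin n) g =
      (Nat.card (MulAction.fixedBy (SubsetsOfCard (Fin n) 0) g) : ℂ) := by
  rw [card_fixedBy_subsetsOfCard (Fintype.card_fin n) h]
  simp

theorem chi_twoRow_succ {n r : ℕ} (h : 2 * (r + 1) ≤ n) (g : Equiv.Perm (Fin n)) :
    chi (twoRow n (r + 1) h) (Fin n) g =
      (Nat.card (MulAction.fixedBy (SubsetsOfCard (Fin n) (r + 1)) g) : ℂ) -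
        (Nat.card (MulAction.fixedBy (SubsetsOfCard (Fin n) r) g) : ℂ) := by
  rw [card_fixedBy_subsetsOfCard (Fintype.card_fin n) h,
    card_fixedBy_subsetsOfCard (Fintype.card_fin n) (by omega), Fin.sum_univ_castSucc]
  simp

end TwistedFoulkes

end

theorem theorem3p1 (n r : ℕ) (h : 2 * r ≤ n) :
    TwistedFoulkes.foulkes 2 (TwistedFoulkes.twoRow n r h) =
      ∑ l : (2 * n).Partition,
        (((∑ α : (n - r).Partition, ∑ β : r.Partition,
              (TwistedFoulkes.lrCoeff l (TwistedFoulkes.double α) (TwistedFoulkes.double β) : ℤ))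
            - (if 1 ≤ r then
                ∑ γ : (n - r + 1).Partition, ∑ δ : (r - 1).Partition,
                  (TwistedFoulkes.lrCoeff l (TwistedFoulkes.double γ)
                    (TwistedFoulkes.double δ) : ℤ)
              else 0) : ℤ) : ℂ) •
          TwistedFoulkes.chi l (Fin n × Fin 2) := by
  rw [TwistedFoulkes.eq_sum_cfInner_chi (n := 2 * n) (by simp [mul_comm])
    (TwistedFoulkes.foulkes 2 (TwistedFoulkes.twoRow n r h))
    (fun g k => Representation.char_conj _ g k)]
  refine Finset.sum_congr rfl fun l _ => ?_
  congr 1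
  rw [TwistedFoulkes.cfInner_foulkes]
  push_cast
  rw [TwistedFoulkes.sum_lrCoeff_double (Nat.sub_add_cancel (by omega))]
  cases r with
  | zero =>
    simp only [TwistedFoulkes.chi_twoRow_zero]
    simp
  | succ r =>
    rw [if_pos (by omega)]
    simp only [TwistedFoulkes.chi_twoRow_succ]
    rw [TwistedFoulkes.sum_lrCoeff_double (by omega), ← TwistedFoulkes.cfInner_sub_left]
    rfl
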